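/- Let $C$ be a connected reduced curve over $\mathbb{C}$, that is, a connected, reduced, proper $\mathbb{C}$-scheme of dimension one, and suppose that $C$ has arithmetic genus zero: $p_a(C) = 1-\chi(\mathcal{O}_C) = 1 - h^0(C,\mathcal{O}_C) + h^1(C,\mathcal{O}_C) = 0$. Then every irreducible component of $C$ (with its reduced scheme structure) is a smooth rational curve. Moreover, every singular point $p$ of $C$ is a rational $k$-fold point for some $k \ge 2$: the formal germ $\operatorname{Spec} \widehat{\mathcal{O}}_{C,p}$ of $C$ at $p$ is the union of $k$ smooth branches whose tangent lines at $p$ are linearly independent in the Zariski tangent space $T_pC$. -/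

import Mathlib

open CategoryTheory AlgebraicGeometry TopologicalSpace IsLocalRing

noncomputable section

namespace CurveGenusZero

/-! ### The cohomology of the structure sheaf and the arithmetic genus -/

/-- The structure sheaf of a scheme `X`, regarded as a sheaf of abelian groups. -/
def structureAbSheaf (X : Scheme.{0}) :
    Sheaf (Opens.grothendieckTopology X) AddCommGrpCat.{0} :=
  (sheafCompose (Opens.grothendieckTopology X)
    (forget₂ CommRingCat.{0} RingCat.{0} ⋙ forget₂ RingCat.{0} AddCommGrpCat.{0})).obj X.sheaf

/-- Multiplication by a global function `a`, as an endomorphism of the structure sheaf: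
on sections over an open `U` it is `x ↦ a|_U * x`. -/
def mulHom (X : Scheme.{0}) (a : Γ(X, ⊤)) : structureAbSheaf X ⟶ structureAbSheaf X where
  hom :=
    { app := fun U => AddCommGrpCat.ofHom (AddMonoidHom.mulLeft
        ((X.presheaf.map (homOfLE (le_top : U.unop ≤ ⊤)).op).hom a : Γ(X, U.unop)))
      naturality := by
        intro U V f
        ext x
        have key : ∀ y : Γ(X, U.unop),
            ((X.presheaf.map (homOfLE (le_top : V.unop ≤ ⊤)).op).hom a : Γ(X, V.unop)) *
              (X.presheaf.map f).hom y =
            (X.presheaf.map f).hom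
              (((X.presheaf.map (homOfLE (le_top : U.unop ≤ ⊤)).op).hom a : Γ(X, U.unop)) * y) := by
          intro y
          rw [map_mul, ← CommRingCat.comp_apply, ← Functor.map_comp]
          rfl
        exact key x }

theorem mulHom_one (X : Scheme.{0}) : mulHom X 1 = 𝟙 _ := by
  ext U x
  have key : ∀ y : Γ(X, U.unop),
      (X.presheaf.map (homOfLE (le_top : U.unop ≤ ⊤)).op).hom 1 * y = y := by
    intro y
    rw [map_one, one_mul]
  exact key x

theorem mulHom_mul (X : Scheme.{0}) (a b : Γ(X, ⊤)) :
    mulHom X (a * b) = mulHom X b ≫ mulHom X a := by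
  ext U x
  have key : ∀ y : Γ(X, U.unop),
      (X.presheaf.map (homOfLE (le_top : U.unop ≤ ⊤)).op).hom (a * b) * y =
        (X.presheaf.map (homOfLE (le_top : U.unop ≤ ⊤)).op).hom a *
          ((X.presheaf.map (homOfLE (le_top : U.unop ≤ ⊤)).op).hom b * y) := by
    intro y
    rw [map_mul, mul_assoc]
  exact key x

theorem mulHom_add (X : Scheme.{0}) (a b : Γ(X, ⊤)) :
    mulHom X (a + b) = mulHom X a + mulHom X b := by
  ext U x
  have key : ∀ y : Γ(X, U.unop),
      (X.presheaf.map (homOfLE (le_top : U.unop ≤ ⊤)).op).hom (a + b) * y =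
        (X.presheaf.map (homOfLE (le_top : U.unop ≤ ⊤)).op).hom a * y +
          (X.presheaf.map (homOfLE (le_top : U.unop ≤ ⊤)).op).hom b * y := by
    intro y
    rw [map_add, add_mul]
  exact key x

theorem mulHom_zero (X : Scheme.{0}) : mulHom X 0 = 0 := by
  ext U x
  have key : ∀ y : Γ(X, U.unop),
      (X.presheaf.map (homOfLE (le_top : U.unop ≤ ⊤)).op).hom 0 * y = 0 := by
    intro y
    rw [map_zero, zero_mul]
  exact key x

instance hasExtAbSheaf (X : Scheme.{0}) :
    HasExt.{0} (Sheaf (Opens.grothendieckTopology X) AddCommGrpCat.{0}) :=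
  hasExt_of_enoughInjectives _

/-- The sheaf cohomology group `Hⁿ(X, 𝒪_X)`. -/
abbrev structureCohomology (X : Scheme.{0}) (n : ℕ) : Type :=
  Sheaf.H.{0} (structureAbSheaf X) n

/-- `Hⁿ(X, 𝒪_X)` is a module over the ring of global functions, which acts by functoriality:
`a` acts through the map induced by multiplication by `a` on `𝒪_X`. -/
instance cohomologyModule (X : Scheme.{0}) (n : ℕ) :
    Module Γ(X, ⊤) (structureCohomology X n) where
  smul a x := Sheaf.H.map (mulHom X a) n x
  one_smul x := by
    change Sheaf.H.map (mulHom X 1) n x = x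
    rw [mulHom_one, Sheaf.H.map_id_apply]
  mul_smul a b x := by
    change Sheaf.H.map (mulHom X (a * b)) n x =
      Sheaf.H.map (mulHom X a) n (Sheaf.H.map (mulHom X b) n x)
    rw [mulHom_mul, Sheaf.H.map_comp_apply]
  smul_zero a := map_zero (Sheaf.H.map (mulHom X a) n)
  smul_add a x y := map_add (Sheaf.H.map (mulHom X a) n) x y
  add_smul a b x := by
    change Sheaf.H.map (mulHom X (a + b)) n x =
      Sheaf.H.map (mulHom X a) n x + Sheaf.H.map (mulHom X b) n x
    rw [mulHom_add, Sheaf.H.map_add_apply]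
  zero_smul x := by
    change Sheaf.H.map (mulHom X 0) n x = 0
    rw [mulHom_zero, Sheaf.H.map_apply, Abelian.Ext.mk₀_zero, Abelian.Ext.comp_zero]

/-- The ring homomorphism `ℂ → Γ(X, 𝒪_X)` of a complex scheme `s : X ⟶ Spec ℂ`. -/
def scalars {X : Scheme.{0}} (s : X ⟶ Spec (.of ℂ)) : ℂ →+* Γ(X, ⊤) :=
  s.appTop.hom.comp (Scheme.ΓSpecIso (.of ℂ)).inv.hom

/-- The dimension `hⁿ(𝒪_X)` of the complex vector space `Hⁿ(X, 𝒪_X)`, as a cardinal. -/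
def hStructure {X : Scheme.{0}} (s : X ⟶ Spec (.of ℂ)) (n : ℕ) : Cardinal.{0} :=
  letI : Module ℂ (structureCohomology X n) := Module.compHom _ (scalars s)
  Module.rank ℂ (structureCohomology X n)

/-- The curve `X` over `ℂ` has arithmetic genus `g`, i.e. `g = 1 - χ(𝒪_X) = 1 - h⁰(𝒪_X) + h¹(𝒪_X)`
(higher cohomology vanishes in dimension one). The equation is written without subtraction, between
cardinals, so that no convention about infinite dimensions enters; for connected reduced
proper `X` one has `h⁰(𝒪_X) = 1` and it says that `h¹(𝒪_X) = g`. -/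
def HasArithmeticGenus {X : Scheme.{0}} (s : X ⟶ Spec (.of ℂ)) (g : ℕ) : Prop :=
  hStructure s 0 + g = 1 + hStructure s 1

/-! ### Components -/

/-- The closed subset `Z` of `X`, with its reduced induced scheme structure. -/
def reducedSubscheme (X : Scheme.{0}) (Z : Closeds X) : Scheme.{0} :=
  (Scheme.IdealSheafData.vanishingIdeal Z).subscheme

/-- The inclusion of a closed subset with its reduced induced scheme structure. -/
def reducedSubschemeι (X : Scheme.{0}) (Z : Closeds X) : reducedSubscheme X Z ⟶ X :=
  (Scheme.IdealSheafData.vanishingIdeal Z).subschemeι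

/-- `t : Z ⟶ Spec ℂ` is a smooth rational curve: it is integral, smooth over `ℂ`, and birational
over `ℂ` to the affine line (equivalently, to the projective line). -/
structure IsSmoothRationalCurve {Z : Scheme.{0}} (t : Z ⟶ Spec (.of ℂ)) : Prop where
  integral : IsIntegral Z
  smooth : Smooth t
  rational : Scheme.BirationalOver t (𝔸(Unit; Spec (.of ℂ)) ↘ Spec (.of ℂ))

/-! ### Rational `k`-fold points -/

/-- A local `ℂ`-algebra `A` (the local ring of a point of a curve) is a rational `k`-fold point if
the formal germ `Spec Â`, with `Â` the completion of `A` at its maximal ideal `𝔪`, is the union of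
`k` smooth branches with linearly independent tangent directions. A smooth branch is a closed
formal arc `Spec ℂ⟦t⟧ ⟶ Spec Â`, given by a surjection `γ : Â ⟶ ℂ⟦t⟧`. That the germ is the union
of the branches means that the kernels of these surjections intersect in zero. The tangent
direction of a branch is spanned by its velocity, the vector of the Zariski tangent space
`(𝔪 / 𝔪²)^∨` sending the class of `a` to the coefficient of `t` in `γ(a)`. -/
def IsRationalFoldLocalRing (A : Type) [CommRing A] [IsLocalRing A] [Algebra ℂ A]
    (k : ℕ) : Prop :=
  ∃ (γ : Fin k → (AdicCompletion (maximalIdeal A) A →ₐ[ℂ] PowerSeries ℂ))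
    (v : Fin k → Module.Dual ℂ (maximalIdeal A).Cotangent),
    (∀ i, Function.Surjective (γ i)) ∧
    (⨅ i, RingHom.ker (γ i)) = ⊥ ∧
    (∀ i (a : maximalIdeal A), v i ((maximalIdeal A).toCotangent a) =
      PowerSeries.coeff 1 (γ i (algebraMap A (AdicCompletion (maximalIdeal A) A) a))) ∧
    LinearIndependent ℂ v

/-- The point `p` of the complex scheme `s : X ⟶ Spec ℂ` is a rational `k`-fold point. -/
def IsRationalFoldPoint {X : Scheme.{0}} (s : X ⟶ Spec (.of ℂ)) (p : X) (k : ℕ) : Prop :=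
  letI : Algebra ℂ (X.presheaf.stalk p) :=
    ((X.presheaf.germ ⊤ p trivial).hom.comp (scalars s)).toAlgebra
  IsRationalFoldLocalRing (X.presheaf.stalk p) k

/-- A singular point: its local ring is not regular. -/
def IsSingularPoint (X : Scheme.{0}) (p : X) : Prop :=
  ¬ IsRegularLocalRing (X.presheaf.stalk p)

end CurveGenusZero

end

noncomputable section

namespace CurveGenusZero

/-! ### Splitting sections when the first cohomology vanishes -/

section MayerVietoris

open Opposite Limits

variable {T : Type} [TopologicalSpace T]

/-- The free abelian presheaf on the whole space is the constant presheaf `ℤ`. -/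
def freeYonedaTopIso (W : Opens T) (hW : W = ⊤) :
    yoneda.obj W ⋙ AddCommGrpCat.free ≅
      (Functor.const (Opens T)ᵒᵖ).obj (AddCommGrpCat.of (ULift.{0} ℤ)) :=
  NatIso.ofComponents
    (fun U =>
      { hom := AddCommGrpCat.ofHom (FreeAbelianGroup.lift fun _ => ULift.up 1)
        inv := AddCommGrpCat.ofHom ((zmultiplesHom _
          (FreeAbelianGroup.of (homOfLE (by rw [hW]; exact le_top) : U.unop ⟶ W))).comp
            AddEquiv.ulift.toAddMonoidHom)
        hom_inv_id := by
          apply AddCommGrpCat.hom_ext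
          apply FreeAbelianGroup.lift_ext
          intro x
          change zmultiplesHom _ (FreeAbelianGroup.of _) (AddEquiv.ulift
            (FreeAbelianGroup.lift (fun _ => ULift.up (1 : ℤ)) (FreeAbelianGroup.of x))) =
              FreeAbelianGroup.of x
          rw [FreeAbelianGroup.lift_apply_of]
          change (1 : ℤ) • (FreeAbelianGroup.of _ : FreeAbelianGroup (U.unop ⟶ W)) = _
          rw [one_smul]
          congr 1
        inv_hom_id := by
          ext ⟨n⟩
          change FreeAbelianGroup.lift (fun _ => ULift.up (1 : ℤ))
            (n • (FreeAbelianGroup.of _ : FreeAbelianGroup (U.unop ⟶ W))) = ULift.up n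
          rw [map_zsmul, FreeAbelianGroup.lift_apply_of]
          ext
          simp })
    (by
      intro U V f
      apply AddCommGrpCat.hom_ext
      apply FreeAbelianGroup.lift_ext
      intro x
      change FreeAbelianGroup.lift _ (FreeAbelianGroup.map _ (FreeAbelianGroup.of x)) =
        FreeAbelianGroup.lift _ (FreeAbelianGroup.of x)
      rw [FreeAbelianGroup.map_of_apply, FreeAbelianGroup.lift_apply_of,
        FreeAbelianGroup.lift_apply_of])

theorem exists_extension_of_shortExact {A : Type*} [Category A] [Abelian A] [HasExt.{0} A]
    {S : ShortComplex A} (hS : S.ShortExact) (F : A) [Subsingleton (Abelian.Ext S.X₃ F 1)]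
    (x : S.X₁ ⟶ F) : ∃ y : S.X₂ ⟶ F, S.f ≫ y = x := by
  obtain ⟨x₂, hx₂⟩ := Abelian.Ext.contravariant_sequence_exact₁ hS F (Abelian.Ext.mk₀ x)
    (n₁ := 1) rfl (Subsingleton.elim _ _)
  obtain ⟨y, rfl⟩ := Abelian.Ext.addEquiv₀.symm.surjective x₂
  refine ⟨y, ?_⟩
  apply (Abelian.Ext.mk₀_bijective _ F).injective
  rw [← hx₂]
  simp

theorem biprod_lift_neg_comp {A : Type*} [Category A] [Abelian A] {X Y Z F : A} (f : X ⟶ Y)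
    (g : X ⟶ Z) (y : Y ⊞ Z ⟶ F) :
    biprod.lift f (-g) ≫ y = f ≫ biprod.inl ≫ y + g ≫ (-(biprod.inr ≫ y)) := by
  simp [biprod.lift_eq]

/-- The section of an abelian sheaf `F` over `U` given by a map from the free sheaf on `U`. -/
def freeSection (U : Opens T) (F : Sheaf (Opens.grothendieckTopology T) AddCommGrpCat.{0})
    (x : (presheafToSheaf (Opens.grothendieckTopology T) AddCommGrpCat.{0}).obj
      (yoneda.obj U ⋙ AddCommGrpCat.free) ⟶ F) : F.obj.obj (op U) :=
  ((sheafificationAdjunction _ _).homEquiv _ _ x).app (op U) (FreeAbelianGroup.of (𝟙 U))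

theorem freeSection_surjective (U : Opens T)
    (F : Sheaf (Opens.grothendieckTopology T) AddCommGrpCat.{0}) :
    Function.Surjective (freeSection U F) := by
  intro s
  let x' : yoneda.obj U ⋙ AddCommGrpCat.free ⟶ F.obj :=
    { app := fun W => AddCommGrpCat.ofHom (FreeAbelianGroup.lift fun i => F.obj.map i.op s)
      naturality := by
        intro W W' f
        apply AddCommGrpCat.hom_ext
        apply FreeAbelianGroup.lift_ext
        intro x
        change FreeAbelianGroup.lift _ (FreeAbelianGroup.map _ (FreeAbelianGroup.of x)) =
          F.obj.map f (FreeAbelianGroup.lift _ (FreeAbelianGroup.of x))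
        rw [FreeAbelianGroup.map_of_apply, FreeAbelianGroup.lift_apply_of,
          FreeAbelianGroup.lift_apply_of]
        exact ConcreteCategory.congr_hom (F.obj.map_comp x.op f) s }
  refine ⟨((sheafificationAdjunction _ _).homEquiv _ _).symm x', ?_⟩
  have : (sheafificationAdjunction (Opens.grothendieckTopology T) AddCommGrpCat.{0}).homEquiv _ _
    (((sheafificationAdjunction _ _).homEquiv _ _).symm x') = x' := Equiv.apply_symm_apply _ _
  rw [freeSection, this]
  change FreeAbelianGroup.lift _ (FreeAbelianGroup.of _) = s
  rw [FreeAbelianGroup.lift_apply_of]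
  exact ConcreteCategory.congr_hom (F.obj.map_id (op U)) s

theorem freeSection_map {U V : Opens T} (i : U ⟶ V)
    (F : Sheaf (Opens.grothendieckTopology T) AddCommGrpCat.{0})
    (x : (presheafToSheaf (Opens.grothendieckTopology T) AddCommGrpCat.{0}).obj
      (yoneda.obj V ⋙ AddCommGrpCat.free) ⟶ F) :
    freeSection U F ((presheafToSheaf _ _).map (Functor.whiskerRight (yoneda.map i) _) ≫ x) =
      F.obj.map i.op (freeSection V F x) := by
  rw [freeSection, freeSection, Adjunction.homEquiv_naturality_left]
  have := ConcreteCategory.congr_hom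
    (((sheafificationAdjunction _ _).homEquiv _ _ x).naturality i.op) (FreeAbelianGroup.of (𝟙 V))
  refine Eq.trans ?_ this
  refine congrArg (((sheafificationAdjunction _ _).homEquiv _ _ x).app (op U)) ?_
  change FreeAbelianGroup.map _ (FreeAbelianGroup.of _) =
    FreeAbelianGroup.map _ (FreeAbelianGroup.of _)
  rw [FreeAbelianGroup.map_of_apply, FreeAbelianGroup.map_of_apply]
  rfl

theorem freeSection_add (U : Opens T) (F : Sheaf (Opens.grothendieckTopology T) AddCommGrpCat.{0})
    (x y : (presheafToSheaf (Opens.grothendieckTopology T) AddCommGrpCat.{0}).obj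
      (yoneda.obj U ⋙ AddCommGrpCat.free) ⟶ F) :
    freeSection U F (x + y) = freeSection U F x + freeSection U F y := by
  simp only [freeSection, Adjunction.homEquiv_unit]
  rfl

/-- The Mayer-Vietoris sequence in degree zero, when the first cohomology of `S.X₄` vanishes. -/
theorem exists_add_of_mayerVietorisSquare
    (S : (Opens.grothendieckTopology T).MayerVietorisSquare)
    (F : Sheaf (Opens.grothendieckTopology T) AddCommGrpCat.{0})
    [HasExt.{0} (Sheaf (Opens.grothendieckTopology T) AddCommGrpCat.{0})]
    [Subsingleton (Abelian.Ext S.shortComplex.X₃ F 1)] (s : F.obj.obj (op S.X₁)) :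
    ∃ (a : F.obj.obj (op S.X₂)) (b : F.obj.obj (op S.X₃)),
      F.obj.map S.f₁₂.op a + F.obj.map S.f₁₃.op b = s := by
  obtain ⟨x, rfl⟩ := freeSection_surjective S.X₁ F s
  obtain ⟨y, hy⟩ := exists_extension_of_shortExact S.shortComplex_shortExact F x
  refine ⟨freeSection _ F (biprod.inl ≫ y), freeSection _ F (-(biprod.inr ≫ y)), ?_⟩
  rw [← freeSection_map, ← freeSection_map, ← hy, ← freeSection_add]
  exact congrArg _ (biprod_lift_neg_comp _ _ y).symm

/-- If `H¹(T, F) = 0`, every section on an intersection `U ∩ V` of two open sets which cover `T`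
is the sum of a section on `U` and a section on `V`. -/
theorem exists_add_of_subsingleton_H
    (F : Sheaf (Opens.grothendieckTopology T) AddCommGrpCat.{0})
    [HasExt.{0} (Sheaf (Opens.grothendieckTopology T) AddCommGrpCat.{0})]
    [Subsingleton (F.H 1)] (U V : Opens T) (hUV : U ⊔ V = ⊤) (s : F.obj.obj (op (U ⊓ V))) :
    ∃ (a : F.obj.obj (op U)) (b : F.obj.obj (op V)),
      F.obj.map (homOfLE inf_le_left).op a + F.obj.map (homOfLE inf_le_right).op b = s := by
  let S := Opens.mayerVietorisSquare U V
  let J := Opens.grothendieckTopology T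
  let e : S.shortComplex.X₃ ≅ (constantSheaf J AddCommGrpCat).obj (AddCommGrpCat.of (ULift ℤ)) :=
    (presheafToSheaf J _).mapIso (freeYonedaTopIso (U ⊔ V) hUV)
  have : Subsingleton (Abelian.Ext S.shortComplex.X₃ F 1) := by
    refine ⟨fun x y => ?_⟩
    have h := Subsingleton.elim (α := F.H 1) ((Abelian.Ext.mk₀ e.inv).comp x (zero_add 1))
      ((Abelian.Ext.mk₀ e.inv).comp y (zero_add 1))
    have h2 := congrArg (fun z => (Abelian.Ext.mk₀ e.hom).comp z (zero_add 1)) h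
    simpa using h2
  exact exists_add_of_mayerVietorisSquare S F s

end MayerVietoris

/-! ### Vanishing of the first cohomology of the structure sheaf -/

theorem hStructure_zero_le_one {X : Scheme.{0}} (s : X ⟶ Spec (.of ℂ))
    (hs : Function.Surjective (scalars s)) : hStructure s 0 ≤ 1 := by
  let _ : Module ℂ (structureCohomology X 0) := Module.compHom _ (scalars s)
  change Module.rank ℂ (structureCohomology X 0) ≤ 1
  let hT : Limits.IsTerminal (⊤ : Opens X) := Limits.isTerminalTop
  let e := Sheaf.H.equiv₀ (structureAbSheaf X) hT
  rw [rank_le_one_iff]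
  let one : (structureAbSheaf X).obj.obj (Opposite.op ⊤) := (1 : Γ(X, ⊤))
  refine ⟨e.symm one, fun v => ?_⟩
  obtain ⟨r, hr⟩ := hs (e v)
  refine ⟨r, ?_⟩
  change Sheaf.H.map (mulHom X (scalars s r)) 0 (e.symm one) = v
  rw [Sheaf.H.equiv₀_symm_naturality, AddEquiv.symm_apply_eq]
  change (X.presheaf.map (homOfLE le_top).op).hom (scalars s r) * (1 : Γ(X, ⊤)) = _
  rw [mul_one, hr]
  exact ConcreteCategory.congr_hom (X.presheaf.map_id (Opposite.op ⊤)) _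

theorem subsingleton_structureCohomology_one {X : Scheme.{0}} (s : X ⟶ Spec (.of ℂ))
    (hs : Function.Surjective (scalars s)) (hg : HasArithmeticGenus s 0) :
    Subsingleton (structureCohomology X 1) := by
  have h0 := hStructure_zero_le_one s hs
  have h1 : hStructure s 1 = 0 := by
    rw [HasArithmeticGenus, Nat.cast_zero, add_zero] at hg
    rw [hg] at h0
    by_contra h
    have h2 : 1 ≤ hStructure s 1 := Cardinal.one_le_iff_ne_zero.2 h
    have h3 : (1 : Cardinal) + 1 ≤ 1 := (add_le_add_right h2 1).trans h0
    norm_num at h3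
  let _ : Module ℂ (structureCohomology X 1) := Module.compHom _ (scalars s)
  exact rank_zero_iff.1 h1

theorem exists_add_of_subsingleton_structureCohomology (X : Scheme.{0})
    [Subsingleton (structureCohomology X 1)] (U V : X.Opens) (hUV : U ⊔ V = ⊤)
    (f : Γ(X, U ⊓ V)) :
    ∃ (a : Γ(X, U)) (b : Γ(X, V)),
      X.presheaf.map (homOfLE inf_le_left).op a + X.presheaf.map (homOfLE inf_le_right).op b = f :=
  exists_add_of_subsingleton_H (structureAbSheaf X) U V hUV f

/-! ### Germs of the affine line -/

open Polynomial

/-- The algebra `D` is the local ring of the affine line at the origin, with coordinate `x`. -/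
structure IsLineGerm (D : Type) [CommRing D] [Algebra ℂ D] (x : D) : Prop where
  isUnit_aeval : ∀ P : ℂ[X], P.eval 0 ≠ 0 → IsUnit (aeval x P)
  exists_mul_eq : ∀ d : D, ∃ P Q : ℂ[X], Q.eval 0 ≠ 0 ∧ d * aeval x Q = aeval x P
  injective_aeval : Function.Injective (aeval x : ℂ[X] → D)

/-- The polynomials which do not vanish at the origin. -/
def nonvanishing : Submonoid ℂ[X] where
  carrier := {P | P.eval 0 ≠ 0}
  one_mem' := by simp
  mul_mem' := by
    intro P Q hP hQ
    simpa using And.intro hP hQ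

namespace IsLineGerm

variable {D : Type} [CommRing D] [Algebra ℂ D] {x : D}

theorem isLocalization (h : IsLineGerm D x) :
    @IsLocalization _ _ nonvanishing D _ (aeval x : ℂ[X] →ₐ[ℂ] D).toRingHom.toAlgebra := by
  let _ : Algebra ℂ[X] D := (aeval x : ℂ[X] →ₐ[ℂ] D).toRingHom.toAlgebra
  refine ⟨fun y => h.isUnit_aeval y y.2, fun d => ?_, fun {P Q} hPQ => ⟨1, ?_⟩⟩
  · obtain ⟨P, Q, hQ, e⟩ := h.exists_mul_eq d
    exact ⟨⟨P, ⟨Q, hQ⟩⟩, e⟩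
  · rw [h.injective_aeval hPQ]

theorem formallySmooth (h : IsLineGerm D x) : Algebra.FormallySmooth ℂ D := by
  let _ : Algebra ℂ[X] D := (aeval x : ℂ[X] →ₐ[ℂ] D).toRingHom.toAlgebra
  have : IsScalarTower ℂ ℂ[X] D := IsScalarTower.of_algebraMap_eq fun c =>
    ((aeval x : ℂ[X] →ₐ[ℂ] D).commutes c).symm
  have := h.isLocalization
  have := Algebra.FormallySmooth.of_isLocalization (Rₘ := D) nonvanishing
  exact Algebra.FormallySmooth.comp ℂ ℂ[X] D

theorem nontrivial (h : IsLineGerm D x) : Nontrivial D := h.injective_aeval.nontrivial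

theorem isUnit_coe {P : ℂ[X]} (hP : P.eval 0 ≠ 0) : IsUnit (P : PowerSeries ℂ) := by
  rw [PowerSeries.isUnit_iff_constantCoeff, Polynomial.constantCoeff_coe,
    ← Polynomial.coeff_zero_eq_eval_zero] at *
  exact isUnit_iff_ne_zero.2 hP

/-- The power series expansion of the elements of a germ of the line. -/
def expand (h : IsLineGerm D x) : D →ₐ[ℂ] PowerSeries ℂ :=
  letI : Algebra ℂ[X] D := (aeval x : ℂ[X] →ₐ[ℂ] D).toRingHom.toAlgebra
  haveI := h.isLocalization
  { IsLocalization.lift (M := nonvanishing) (S := D) (g := Polynomial.coeToPowerSeries.ringHom)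
      fun y => isUnit_coe y.2 with
    commutes' := by
      intro c
      have : algebraMap ℂ D c = algebraMap ℂ[X] D (C c) := by
        exact ((aeval x : ℂ[X] →ₐ[ℂ] D).commutes c).symm
      rw [this]
      refine (IsLocalization.lift_eq _ _).trans ?_
      simp }

theorem expand_aeval (h : IsLineGerm D x) (P : ℂ[X]) : h.expand (aeval x P) = P := by
  let _ : Algebra ℂ[X] D := (aeval x : ℂ[X] →ₐ[ℂ] D).toRingHom.toAlgebra
  have := h.isLocalization
  exact IsLocalization.lift_eq (M := nonvanishing) (S := D)
    (g := Polynomial.coeToPowerSeries.ringHom) (fun y => isUnit_coe y.2) P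

theorem expand_self (h : IsLineGerm D x) : h.expand x = PowerSeries.X := by
  simpa using h.expand_aeval X

theorem X_pow_dvd_expand_iff (h : IsLineGerm D x) (n : ℕ) (d : D) :
    PowerSeries.X ^ n ∣ h.expand d ↔ x ^ n ∣ d := by
  constructor
  · intro hd
    obtain ⟨P, Q, hQ, e⟩ := h.exists_mul_eq d
    have h1 : PowerSeries.X ^ n ∣ (P : PowerSeries ℂ) := by
      rw [← h.expand_aeval P, ← e, map_mul]
      exact hd.mul_right _
    have h2 : X ^ n ∣ P := by
      rw [Polynomial.X_pow_dvd_iff]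
      rw [PowerSeries.X_pow_dvd_iff] at h1
      simpa using h1
    obtain ⟨P', rfl⟩ := h2
    rw [← (h.isUnit_aeval Q hQ).dvd_mul_right, e]
    simp
  · rintro ⟨d', rfl⟩
    simp [h.expand_self]

theorem not_isUnit_self (h : IsLineGerm D x) : ¬ IsUnit x := by
  intro hx
  have := hx.map h.expand
  rw [h.expand_self, PowerSeries.isUnit_iff_constantCoeff] at this
  simp at this

theorem self_dvd_of_not_isUnit (h : IsLineGerm D x) {d : D} (hd : ¬ IsUnit d) : x ∣ d := by
  obtain ⟨P, Q, hQ, e⟩ := h.exists_mul_eq d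
  have hP : P.eval 0 = 0 := by
    by_contra hP
    have := h.isUnit_aeval P hP
    rw [← e] at this
    exact hd (isUnit_of_mul_isUnit_left this)
  obtain ⟨P', rfl⟩ := Polynomial.X_dvd_iff.2 ((Polynomial.coeff_zero_eq_eval_zero P).trans hP)
  rw [← (h.isUnit_aeval Q hQ).dvd_mul_right, e]
  simp

end IsLineGerm

/-! ### Unions of smooth branches with independent tangents -/

theorem exists_linearMap_cotangent {A : Type} [CommRing A] [IsLocalRing A] [Algebra ℂ A]
    (f : A →ₗ[ℂ] ℂ) (hf : ∀ a ∈ maximalIdeal A ^ 2, f a = 0) :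
    ∃ v : Module.Dual ℂ (maximalIdeal A).Cotangent,
      ∀ a : maximalIdeal A, v ((maximalIdeal A).toCotangent a) = f a := by
  let r := Function.surjInv (maximalIdeal A).toCotangent_surjective
  have hr (a : maximalIdeal A) : f (r ((maximalIdeal A).toCotangent a)) = f a := by
    rw [← sub_eq_zero, ← map_sub]
    exact hf _ ((maximalIdeal A).toCotangent_eq.1 (Function.surjInv_eq _ _))
  refine ⟨{ toFun := fun z => f (r z), map_add' := ?_, map_smul' := ?_ }, hr⟩
  · intro y z
    obtain ⟨a, rfl⟩ := (maximalIdeal A).toCotangent_surjective y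
    obtain ⟨b, rfl⟩ := (maximalIdeal A).toCotangent_surjective z
    rw [← map_add, hr, hr, hr]
    exact map_add f _ _
  · intro c z
    obtain ⟨a, rfl⟩ := (maximalIdeal A).toCotangent_surjective z
    rw [← LinearMap.map_smul_of_tower, hr, hr]
    exact map_smul f c _

/-- A local `ℂ`-algebra `A` with germs of the line `D i` as branches, such that every family of
functions on the branches is, up to constants, induced by an element of `A`. -/
structure IsFoldedGerm (A : Type) [CommRing A] [IsLocalRing A] [Algebra ℂ A] {k : ℕ}
    (D : Fin k → Type) [∀ i, CommRing (D i)] [∀ i, Algebra ℂ (D i)] (x : ∀ i, D i)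
    (π : ∀ i, A →ₐ[ℂ] D i) : Prop where
  isLineGerm : ∀ i, IsLineGerm (D i) (x i)
  surjective : ∀ i, Function.Surjective (π i)
  eq_zero : ∀ a, (∀ i, π i a = 0) → a = 0
  exists_sub_mem : ∀ a : A, ∃ c : ℂ, a - algebraMap ℂ A c ∈ maximalIdeal A
  exists_add : ∀ d : ∀ i, D i, ∃ (c : Fin k → ℂ) (h : A),
    ∀ i, algebraMap ℂ (D i) (c i) + π i h = d i

namespace IsFoldedGerm

variable {A : Type} [CommRing A] [IsLocalRing A] [Algebra ℂ A] {k : ℕ}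
  {D : Fin k → Type} [∀ i, CommRing (D i)] [∀ i, Algebra ℂ (D i)] {x : ∀ i, D i}
  {π : ∀ i, A →ₐ[ℂ] D i} (H : IsFoldedGerm A D x π)
include H

theorem dvd_of_mem (i : Fin k) {a : A} (ha : a ∈ maximalIdeal A) : x i ∣ π i a := by
  apply (H.isLineGerm i).self_dvd_of_not_isUnit
  intro hu
  obtain ⟨b', hb'⟩ := hu.exists_right_inv
  obtain ⟨b, rfl⟩ := H.surjective i b'
  have h1 : 1 - a * b ∈ nonunits A := by
    intro h
    have h2 := h.map (π i)
    rw [map_sub, map_mul, hb', map_one, sub_self] at h2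
    have := (H.isLineGerm i).nontrivial
    exact not_isUnit_zero h2
  have h3 : a * b ∈ maximalIdeal A := Ideal.mul_mem_right _ _ ha
  have h4 : (1 : A) ∈ maximalIdeal A := by
    have := (maximalIdeal A).add_mem ((mem_maximalIdeal _).2 h1) h3
    rwa [sub_add_cancel] at this
  exact (maximalIdeal.isMaximal A).ne_top ((Ideal.eq_top_iff_one _).2 h4)

theorem exists_mem_of_dvd (d : ∀ i, D i) (hd : ∀ i, x i ∣ d i) :
    ∃ a ∈ maximalIdeal A, ∀ i, π i a = d i := by
  obtain ⟨c, h, e⟩ := H.exists_add d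
  obtain ⟨b, hb⟩ := H.exists_sub_mem h
  refine ⟨_, hb, fun i => ?_⟩
  have h1 : x i ∣ algebraMap ℂ (D i) (c i + b) := by
    have h2 := dvd_sub (hd i) (H.dvd_of_mem i hb)
    rw [← e i, map_sub, AlgHom.commutes] at h2
    rw [map_add]
    convert h2 using 1
    ring
  have h3 : c i + b = 0 := by
    by_contra hne
    exact (H.isLineGerm i).not_isUnit_self
      (isUnit_of_dvd_unit h1 ((isUnit_iff_ne_zero.2 hne).map _))
  rw [← e i, map_sub, AlgHom.commutes, eq_neg_of_add_eq_zero_left h3, map_neg]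
  ring

theorem exists_parameters : ∃ e : Fin k → A, (∀ i, e i ∈ maximalIdeal A) ∧
    ∀ i j, π j (e i) = if j = i then x j else 0 := by
  have (i : Fin k) := H.exists_mem_of_dvd (fun j => if j = i then x j else 0) (fun j => by
    split_ifs
    · exact dvd_rfl
    · exact dvd_zero _)
  choose e he he' using this
  exact ⟨e, he, he'⟩

theorem mem_pow_of_dvd {n : ℕ} {a : A} (ha : ∀ i, x i ^ n ∣ π i a) : a ∈ maximalIdeal A ^ n := by
  obtain rfl | hn := eq_or_ne n 0
  · simp
  obtain ⟨e, he, he'⟩ := H.exists_parameters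
  choose u hu using ha
  choose b hb using fun i => H.surjective i (u i)
  have : a = ∑ i, e i ^ n * b i := by
    rw [← sub_eq_zero]
    apply H.eq_zero
    intro j
    rw [map_sub, map_sum, Finset.sum_eq_single j]
    · rw [map_mul, map_pow, he', if_pos rfl, hb, hu, sub_self]
    · intro i _ hij
      rw [map_mul, map_pow, he', if_neg hij.symm, zero_pow hn, zero_mul]
    · simp
  rw [this]
  exact Ideal.sum_mem _ fun i _ => Ideal.mul_mem_right _ _ (Ideal.pow_mem_pow (he i) n)

theorem X_pow_dvd_of_mem (i : Fin k) {n : ℕ} {a : A} (ha : a ∈ maximalIdeal A ^ n) :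
    PowerSeries.X ^ n ∣ (H.isLineGerm i).expand (π i a) := by
  have h1 : (maximalIdeal A).map (((H.isLineGerm i).expand.comp (π i) : A →ₐ[ℂ] PowerSeries ℂ)) ≤
      Ideal.span {PowerSeries.X} := by
    rw [Ideal.map_le_iff_le_comap]
    intro b hb
    rw [Ideal.mem_comap, Ideal.mem_span_singleton]
    have := ((H.isLineGerm i).X_pow_dvd_expand_iff 1 (π i b)).2 (by simpa using H.dvd_of_mem i hb)
    simpa using this
  have h2 := Ideal.mem_map_of_mem ((H.isLineGerm i).expand.comp (π i) : A →ₐ[ℂ] PowerSeries ℂ) ha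
  rw [Ideal.map_pow] at h2
  have h3 := Ideal.pow_right_mono h1 n h2
  rwa [Ideal.span_singleton_pow, Ideal.mem_span_singleton] at h3

/-- The expansion along the `i`-th branch, modulo `n`-th powers. -/
def quotientBranch (i : Fin k) (n : ℕ) : A ⧸ maximalIdeal A ^ n →ₐ[ℂ]
    PowerSeries ℂ ⧸ (Ideal.span {PowerSeries.X} : Ideal (PowerSeries ℂ)) ^ n :=
  Ideal.Quotient.liftₐ (maximalIdeal A ^ n)
    ((Ideal.Quotient.mkₐ ℂ _).comp ((H.isLineGerm i).expand.comp (π i))) (fun a ha => by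
      have := H.X_pow_dvd_of_mem i ha
      rw [← Ideal.mem_span_singleton, ← Ideal.span_singleton_pow] at this
      exact Ideal.Quotient.eq_zero_iff_mem.2 this)

/-- The truncated expansion along the `i`-th branch. -/
def truncatedBranch (i : Fin k) (n : ℕ) :
    AdicCompletion (maximalIdeal A) A →ₐ[ℂ]
      PowerSeries ℂ ⧸ (Ideal.span {PowerSeries.X} : Ideal (PowerSeries ℂ)) ^ n :=
  (H.quotientBranch i n).comp ((AdicCompletion.evalₐ (maximalIdeal A) n).restrictScalars ℂ)

theorem truncatedBranch_eq (i : Fin k) (n : ℕ) (z : AdicCompletion (maximalIdeal A) A) (a : A)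
    (h : AdicCompletion.evalₐ (maximalIdeal A) n z = Ideal.Quotient.mk _ a) :
    H.truncatedBranch i n z = Ideal.Quotient.mk _ ((H.isLineGerm i).expand (π i a)) :=
  congrArg (H.quotientBranch i n) h

theorem factor_truncatedBranch (i : Fin k) {m n : ℕ} (hmn : m ≤ n) :
    (Ideal.Quotient.factorₐ ℂ (Ideal.pow_le_pow_right hmn)).comp (H.truncatedBranch i n) =
      H.truncatedBranch i m := by
  ext z
  obtain ⟨a, rfl⟩ := AdicCompletion.mk_surjective _ _ z
  rw [AlgHom.comp_apply, H.truncatedBranch_eq i n _ _ (AdicCompletion.evalₐ_mk _ n a),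
    H.truncatedBranch_eq i m _ (a n) (by
      rw [AdicCompletion.evalₐ_mk]
      exact (AdicCompletion.Ideal.mk_eq_mk _ hmn a).symm)]
  rfl

/-- The `i`-th branch of the formal germ. -/
def branch (i : Fin k) : AdicCompletion (maximalIdeal A) A →ₐ[ℂ] PowerSeries ℂ :=
  IsAdicComplete.liftAlgHom (Ideal.span {PowerSeries.X}) (H.truncatedBranch i)
    (H.factor_truncatedBranch i)

theorem X_pow_dvd_branch_sub (i : Fin k) (n : ℕ) (z : AdicCompletion (maximalIdeal A) A) (a : A)
    (h : AdicCompletion.evalₐ (maximalIdeal A) n z = Ideal.Quotient.mk _ a) :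
    PowerSeries.X ^ n ∣ H.branch i z - (H.isLineGerm i).expand (π i a) := by
  rw [← Ideal.mem_span_singleton, ← Ideal.span_singleton_pow, ← Ideal.Quotient.mk_eq_mk_iff_sub_mem]
  exact (IsAdicComplete.mk_liftAlgHom _ _ (H.factor_truncatedBranch i) n z).trans
    (H.truncatedBranch_eq i n z a h)

theorem branch_of (i : Fin k) (a : A) :
    H.branch i (algebraMap A (AdicCompletion (maximalIdeal A) A) a) =
      (H.isLineGerm i).expand (π i a) := by
  rw [← sub_eq_zero]
  ext n
  exact PowerSeries.X_pow_dvd_iff.1 (H.X_pow_dvd_branch_sub i (n + 1) _ a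
    (AdicCompletion.evalₐ_of _ _ _)) n n.lt_succ_self

theorem branch_surjective (i : Fin k) : Function.Surjective (H.branch i) := by
  intro f
  obtain ⟨e, he, he'⟩ := H.exists_parameters
  have hstep (n : ℕ) : Polynomial.aeval (e i) (f.trunc (n + 1)) =
      Polynomial.aeval (e i) (f.trunc n) + algebraMap ℂ A (PowerSeries.coeff n f) * e i ^ n := by
    rw [PowerSeries.trunc_succ, map_add, Polynomial.aeval_monomial]
  let a : AdicCompletion.AdicCauchySequence (maximalIdeal A) A :=
    AdicCompletion.AdicCauchySequence.mk _ _ (fun n => Polynomial.aeval (e i) (f.trunc n)) (by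
      intro n
      rw [hstep, SModEq.sub_mem, sub_add_cancel_left, neg_mem_iff, smul_eq_mul, Ideal.mul_top]
      exact Ideal.mul_mem_left _ _ (Ideal.pow_mem_pow (he i) n))
  refine ⟨AdicCompletion.mk _ _ a, ?_⟩
  rw [← sub_eq_zero]
  ext n
  have h1 := H.X_pow_dvd_branch_sub i (n + 1) _ _ (AdicCompletion.evalₐ_mk _ (n + 1) a)
  have h2 := PowerSeries.X_pow_dvd_iff.1 h1 n n.lt_succ_self
  have h3 : (H.isLineGerm i).expand (π i (a (n + 1))) = (f.trunc (n + 1) : Polynomial ℂ) := by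
    change (H.isLineGerm i).expand (π i (Polynomial.aeval (e i) (f.trunc (n + 1)))) = _
    rw [← Polynomial.aeval_algHom_apply, he', if_pos rfl, IsLineGerm.expand_aeval]
  rw [h3, map_sub, Polynomial.coeff_coe, PowerSeries.coeff_trunc, if_pos n.lt_succ_self] at h2
  rw [map_sub, h2]
  rfl

theorem iInf_ker_branch : ⨅ i, RingHom.ker (H.branch i) = ⊥ := by
  rw [eq_bot_iff]
  intro z hz
  rw [Submodule.mem_iInf] at hz
  obtain ⟨a, rfl⟩ := AdicCompletion.mk_surjective _ _ z
  change _ = _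
  apply AdicCompletion.ext_evalₐ
  intro n
  rw [AdicCompletion.evalₐ_mk, map_zero, Ideal.Quotient.eq_zero_iff_mem]
  apply H.mem_pow_of_dvd
  intro i
  rw [← (H.isLineGerm i).X_pow_dvd_expand_iff]
  have h1 := H.X_pow_dvd_branch_sub i n _ _ (AdicCompletion.evalₐ_mk _ n a)
  rw [(RingHom.mem_ker).1 (hz i), zero_sub, dvd_neg] at h1
  exact h1

theorem isRationalFoldLocalRing : IsRationalFoldLocalRing A k := by
  have (i : Fin k) := exists_linearMap_cotangent
    ((PowerSeries.coeff 1 : PowerSeries ℂ →ₗ[ℂ] ℂ).comp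
      ((H.isLineGerm i).expand.comp (π i)).toLinearMap)
    (fun a ha => PowerSeries.X_pow_dvd_iff.1 (H.X_pow_dvd_of_mem i ha) 1 one_lt_two)
  choose v hv using this
  have hv (i : Fin k) (a : maximalIdeal A) : v i ((maximalIdeal A).toCotangent a) =
    PowerSeries.coeff 1 ((H.isLineGerm i).expand (π i a)) := hv i a
  refine ⟨H.branch, v, H.branch_surjective, H.iInf_ker_branch, fun i a => ?_, ?_⟩
  · rw [H.branch_of, hv]
  · obtain ⟨e, he, he'⟩ := H.exists_parameters
    rw [Fintype.linearIndependent_iff]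
    intro c hc j
    have h1 := LinearMap.congr_fun hc ((maximalIdeal A).toCotangent ⟨e j, he j⟩)
    rw [LinearMap.sum_apply, Finset.sum_eq_single j] at h1
    · rw [LinearMap.smul_apply, hv, he', if_pos rfl, IsLineGerm.expand_self] at h1
      simpa using h1
    · intro i _ hij
      rw [LinearMap.smul_apply, hv, he', if_neg hij]
      simp
    · simp

end IsFoldedGerm

/-! ### Function fields in which every principal part is realized -/

open Polynomial IntermediateField

section LineGerm

variable {D K : Type} [CommRing D] [IsLocalRing D] [Algebra ℂ D] [Field K] [Algebra ℂ K]
  [Algebra D K] [IsScalarTower ℂ D K]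

theorem isUnit_aeval_of_mem {x : D} (hx : x ∈ maximalIdeal D) {P : ℂ[X]} (hP : P.eval 0 ≠ 0) :
    IsUnit (aeval x P) := by
  by_contra hu
  have h1 : aeval x P - algebraMap ℂ D (P.eval 0) ∈ maximalIdeal D := by
    have : P - C (P.eval 0) = X * divX P := by
      conv_lhs => rw [← divX_mul_X_add P]
      simp
      ring
    have h2 := congrArg (aeval x) this
    rw [map_sub, aeval_C, map_mul, aeval_X] at h2
    rw [h2]
    exact Ideal.mul_mem_right _ _ hx
  have h2 := (maximalIdeal D).sub_mem ((mem_maximalIdeal _).2 hu) h1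
  rw [sub_sub_cancel] at h2
  exact (mem_maximalIdeal _).1 h2 ((isUnit_iff_ne_zero.2 hP).map _)

theorem isLineGerm_of_adjoin_eq_top [IsDomain D] [IsFractionRing D K] {x : D}
    (hx : x ∈ maximalIdeal D) (htop : ℂ⟮algebraMap D K x⟯ = ⊤)
    (hinj : Function.Injective (aeval (algebraMap D K x) : ℂ[X] → K)) : IsLineGerm D x := by
  have hinj' : Function.Injective (aeval x : ℂ[X] → D) := by
    intro P Q hPQ
    apply hinj
    rw [aeval_algebraMap_apply, aeval_algebraMap_apply, hPQ]
  refine ⟨fun P hP => isUnit_aeval_of_mem hx hP, fun d => ?_, hinj'⟩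
  have hd : algebraMap D K d ∈ ℂ⟮algebraMap D K x⟯ := by rw [htop]; trivial
  obtain ⟨P, Q, e⟩ := (mem_adjoin_simple_iff _ _).1 hd
  obtain rfl | hQ := eq_or_ne Q 0
  · refine ⟨0, 1, by simp, ?_⟩
    have : d = 0 := by
      apply IsFractionRing.injective D K
      rw [e]
      simp
    simp [this]
  have hQ' : aeval (algebraMap D K x) Q ≠ 0 := by
    intro h
    exact hQ (hinj (h.trans (map_zero _).symm))
  have e' : d * aeval x Q = aeval x P := by
    apply IsFractionRing.injective D K
    rw [map_mul, ← aeval_algebraMap_apply, ← aeval_algebraMap_apply, e, div_mul_cancel₀ _ hQ']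
  clear e hQ' hd
  induction hn : Q.natDegree generalizing P Q with
  | zero =>
    refine ⟨P, Q, ?_, e'⟩
    rw [natDegree_eq_zero] at hn
    obtain ⟨c, rfl⟩ := hn
    simpa using hQ
  | succ n ih =>
    by_cases h0 : Q.eval 0 = 0
    · obtain ⟨Q', rfl⟩ := Polynomial.X_dvd_iff.2 ((Polynomial.coeff_zero_eq_eval_zero Q).trans h0)
      have hP : P.eval 0 = 0 := by
        by_contra hP
        have h1 := isUnit_aeval_of_mem hx hP
        rw [← e', map_mul, aeval_X] at h1
        exact (mem_maximalIdeal _).1 (Ideal.mul_mem_left _ d (Ideal.mul_mem_right _ _ hx)) h1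
      obtain ⟨P', rfl⟩ := Polynomial.X_dvd_iff.2 ((Polynomial.coeff_zero_eq_eval_zero P).trans hP)
      have hQ' : Q' ≠ 0 := right_ne_zero_of_mul hQ
      refine ih P' Q' hQ' ?_ ?_
      · have hx0 : x ≠ 0 := by
          rintro rfl
          have : (aeval (0 : D) : ℂ[X] →ₐ[ℂ] D) X = (aeval (0 : D) : ℂ[X] →ₐ[ℂ] D) 0 := by simp
          exact X_ne_zero (hinj' this)
        apply mul_left_cancel₀ hx0
        rw [map_mul, map_mul, aeval_X] at e'
        linear_combination e'
      · rw [natDegree_X_mul hQ'] at hn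
        omega
    · exact ⟨P, Q, h0, e'⟩

end LineGerm

theorem exists_pow_mul_mem_range {D K : Type} [CommRing D] [IsDomain D]
    [IsDiscreteValuationRing D] [Field K] [Algebra D K] [IsFractionRing D K]
    {y : D} (hy : y ∈ maximalIdeal D) (x : K) :
    ∃ (n : ℕ) (d : D), algebraMap D K d = algebraMap D K y ^ n * x := by
  obtain ⟨a, b, hb, rfl⟩ := IsFractionRing.div_surjective (A := D) x
  obtain ⟨ϖ, hϖ⟩ := IsDiscreteValuationRing.exists_irreducible D
  obtain ⟨n, u, rfl⟩ := IsDiscreteValuationRing.eq_unit_mul_pow_irreducible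
    (nonZeroDivisors.ne_zero hb) hϖ
  rw [(IsDiscreteValuationRing.irreducible_iff_uniformizer _).1 hϖ, Ideal.mem_span_singleton] at hy
  obtain ⟨y', rfl⟩ := hy
  refine ⟨n, ↑u⁻¹ * y' ^ n * a, ?_⟩
  have hu : algebraMap D K ↑u⁻¹ * algebraMap D K u = 1 := by
    rw [← map_mul, Units.inv_mul, map_one]
  have hne := IsFractionRing.to_map_ne_zero_of_mem_nonZeroDivisors (K := K) hb
  rw [eq_comm, mul_div_assoc', div_eq_iff hne]
  simp only [map_mul, map_pow]
  linear_combination - (algebraMap D K ϖ ^ n * algebraMap D K y' ^ n * algebraMap D K a) * hu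

/-- A family of Noetherian local rings `R q` in a field `K` of algebraic functions over `ℂ`, the
local rings at the closed points of a complete curve all of whose principal parts are realized by
functions. -/
structure IsCousinFamily (K : Type) [Field K] [Algebra ℂ K] {Q : Type} (R : Q → Type)
    [∀ q, CommRing (R q)] [∀ q, IsLocalRing (R q)] [∀ q, Algebra ℂ (R q)]
    [∀ q, Algebra (R q) K] : Prop where
  not_isField : ∀ q, ¬ IsField (R q)
  eq_maximalIdeal : ∀ q (P : Ideal (R q)), P ≠ ⊥ → P.IsPrime → P = maximalIdeal (R q)
  exists_sub_mem : ∀ q (a : R q), ∃ c : ℂ, a - algebraMap ℂ (R q) c ∈ maximalIdeal (R q)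
  finite : ∀ x : K, {q | x ∉ (algebraMap (R q) K).range}.Finite
  eq_const : ∀ x : K, (∀ q, IsIntegral (R q) x) → ∃ c : ℂ, algebraMap ℂ K c = x
  exists_add : ∀ q (x : K), ∃ g : K, (∀ q' ≠ q, g ∈ (algebraMap (R q') K).range) ∧
    ∃ h : R q, g + algebraMap (R q) K h = x

namespace IsCousinFamily

variable {K : Type} [Field K] [Algebra ℂ K] {Q : Type} {R : Q → Type}
  [∀ q, CommRing (R q)] [∀ q, IsLocalRing (R q)] [∀ q, Algebra ℂ (R q)]
  [∀ q, Algebra (R q) K] (H : IsCousinFamily K R) [∀ q, IsScalarTower ℂ (R q) K]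
include H

omit [∀ q, IsScalarTower ℂ (R q) K] in
theorem eq_const_of_mem_range {x : K} (hx : ∀ q, x ∈ (algebraMap (R q) K).range) :
    ∃ c : ℂ, algebraMap ℂ K c = x :=
  H.eq_const x fun q => by
    obtain ⟨y, rfl⟩ := hx q
    exact isIntegral_algebraMap

theorem isIntegrallyClosed [∀ q, IsDomain (R q)] [∀ q, IsFractionRing (R q) K] (q : Q) :
    IsIntegrallyClosed (R q) := by
  rw [isIntegrallyClosed_iff K]
  intro x hx
  obtain ⟨g, hg, h, rfl⟩ := H.exists_add q x
  obtain ⟨c, rfl⟩ := H.eq_const g (fun q' => by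
    by_cases e : q' = q
    · subst e
      simpa using hx.sub (isIntegral_algebraMap (x := h))
    · obtain ⟨y, rfl⟩ := hg q' e
      exact isIntegral_algebraMap)
  exact ⟨algebraMap ℂ (R q) c + h, by
    rw [map_add, ← IsScalarTower.algebraMap_apply]⟩

variable [∀ q, IsDomain (R q)] [∀ q, IsFractionRing (R q) K] [∀ q, IsNoetherianRing (R q)]

theorem isDiscreteValuationRing (q : Q) : IsDiscreteValuationRing (R q) := by
  have h : IsIntegrallyClosed (R q) ∧
      ∀ P : Ideal (R q), P ≠ ⊥ → P.IsPrime → P = maximalIdeal (R q) :=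
    ⟨H.isIntegrallyClosed q, H.eq_maximalIdeal q⟩
  have : IsPrincipalIdealRing (R q) :=
    ((tfae_of_isNoetherianRing_of_isLocalRing_of_isDomain (R q)).out 3 0).1 h
  exact { not_a_field' := fun h => H.not_isField q (isField_iff_maximalIdeal_eq.2 h) }

/-- There is a function with a simple pole at `p` and no other poles. -/
theorem exists_simple_pole (p : Q) : ∃ (g : K) (w : R p), maximalIdeal (R p) = Ideal.span {w} ∧
    (∀ q ≠ p, g ∈ (algebraMap (R q) K).range) ∧ algebraMap (R p) K w * g = 1 := by
  have := H.isDiscreteValuationRing p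
  obtain ⟨ϖ, hϖ⟩ := IsDiscreteValuationRing.exists_irreducible (R p)
  obtain ⟨g, hg, h, e⟩ := H.exists_add p (algebraMap (R p) K ϖ)⁻¹
  have hmem : ϖ ∈ maximalIdeal (R p) := (mem_maximalIdeal _).2 hϖ.not_isUnit
  have hϖ0 : algebraMap (R p) K ϖ ≠ 0 := by simpa using hϖ.ne_zero
  have hu : IsUnit (1 - ϖ * h) := by
    by_contra hu
    have := (maximalIdeal (R p)).add_mem ((mem_maximalIdeal _).2 hu)
      (Ideal.mul_mem_right h _ hmem)
    rw [sub_add_cancel] at this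
    exact (mem_maximalIdeal _).1 this isUnit_one
  obtain ⟨v, hv⟩ := hu.exists_right_inv
  refine ⟨g, ϖ * v, ?_, hg, ?_⟩
  · rw [(IsDiscreteValuationRing.irreducible_iff_uniformizer _).1 hϖ,
      Ideal.span_singleton_mul_right_unit (IsUnit.of_mul_eq_one_right _ hv)]
  have hv' := congrArg (algebraMap (R p) K) hv
  rw [eq_sub_of_add_eq e, map_mul]
  simp only [map_mul, map_sub, map_one] at hv'
  field_simp
  linear_combination hv'

variable {p : Q} {g : K} {w : R p} (hw : maximalIdeal (R p) = Ideal.span {w})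
  (hg : ∀ q ≠ p, g ∈ (algebraMap (R q) K).range) (hwg : algebraMap (R p) K w * g = 1)
include hw hg hwg

omit [∀ q, IsDomain (R q)] [∀ q, IsFractionRing (R q) K] [∀ q, IsNoetherianRing (R q)] in
theorem exists_aeval_eq (n : ℕ) (x : K) (hx : ∀ q ≠ p, x ∈ (algebraMap (R q) K).range)
    (y : R p) (hy : algebraMap (R p) K y = algebraMap (R p) K w ^ n * x) :
    ∃ P : ℂ[X], aeval g P = x := by
  induction n generalizing x y with
  | zero =>
    obtain ⟨c, rfl⟩ := H.eq_const_of_mem_range (x := x) (fun q => by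
      by_cases e : q = p
      · subst e
        exact ⟨y, by simpa using hy⟩
      · exact hx q e)
    exact ⟨C c, by simp⟩
  | succ n ih =>
    obtain ⟨c, hc⟩ := H.exists_sub_mem p y
    rw [hw, Ideal.mem_span_singleton] at hc
    obtain ⟨y', hy'⟩ := hc
    have hc' : algebraMap (R p) K (algebraMap ℂ (R p) c) = algebraMap ℂ K c :=
      (IsScalarTower.algebraMap_apply _ _ _ _).symm
    have e1 : algebraMap (R p) K w ^ (n + 1) * x =
        algebraMap ℂ K c + algebraMap (R p) K w * algebraMap (R p) K y' := by
      rw [← hy, eq_add_of_sub_eq hy', map_add, map_mul, hc']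
      ring
    have e2 : algebraMap (R p) K w ^ n * g ^ n = 1 := by rw [← mul_pow, hwg, one_pow]
    obtain ⟨P, hP⟩ := ih (x - algebraMap ℂ K c * g ^ (n + 1)) (fun q hq => by
      refine sub_mem (hx q hq) (mul_mem ?_ (pow_mem (hg q hq) _))
      exact ⟨algebraMap ℂ (R q) c, (IsScalarTower.algebraMap_apply _ _ _ _).symm⟩) y' (by
      linear_combination (-g) * e1 - (algebraMap (R p) K y' -
        algebraMap (R p) K w ^ n * x) * hwg + algebraMap ℂ K c * g * e2)
    exact ⟨P + C c * X ^ (n + 1), by simp [hP]⟩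

omit H [Algebra ℂ K] [∀ q, Algebra ℂ (R q)] [∀ q, IsScalarTower ℂ (R q) K]
  [∀ q, IsDomain (R q)] [∀ q, IsNoetherianRing (R q)] hg in
theorem notMem_range : g ∉ (algebraMap (R p) K).range := by
  rintro ⟨y, rfl⟩
  rw [← map_mul, ← map_one (algebraMap (R p) K)] at hwg
  have := IsFractionRing.injective (R p) K hwg
  have hw' : w ∈ maximalIdeal (R p) := by
    rw [hw]
    exact Ideal.mem_span_singleton_self w
  exact (mem_maximalIdeal _).1 hw' (IsUnit.of_mul_eq_one _ this)

omit H [∀ q, IsDomain (R q)] [∀ q, IsNoetherianRing (R q)] hg in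
theorem injective_aeval : Function.Injective (aeval g : ℂ[X] → K) := by
  rw [← transcendental_iff_injective]
  intro hal
  obtain ⟨c, rfl⟩ := minpoly.mem_range_of_degree_eq_one ℂ g
    (IsAlgClosed.degree_eq_one_of_irreducible ℂ (minpoly.irreducible hal.isIntegral))
  apply notMem_range hw hwg
  exact ⟨algebraMap ℂ (R p) c, (IsScalarTower.algebraMap_apply _ _ _ _).symm⟩

theorem adjoin_eq_top : ℂ⟮g⟯ = ⊤ := by
  have := H.isDiscreteValuationRing
  have hw' : w ∈ maximalIdeal (R p) := by
    rw [hw]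
    exact Ideal.mem_span_singleton_self w
  have hgmem : g ∈ ℂ⟮g⟯ := mem_adjoin_simple_self ℂ g
  have key : ∀ (F : Finset Q) (x : K),
      (∀ q ≠ p, q ∉ F → x ∈ (algebraMap (R q) K).range) → x ∈ ℂ⟮g⟯ := by
    classical
    intro F
    induction F using Finset.induction_on with
    | empty =>
      intro x hx
      obtain ⟨n, y, hy⟩ := exists_pow_mul_mem_range hw' x
      obtain ⟨P, rfl⟩ := H.exists_aeval_eq hw hg hwg n x (fun q hq => hx q hq (by simp)) y hy
      exact (mem_adjoin_simple_iff _ _).2 ⟨P, 1, by simp⟩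
    | insert q F hq ih =>
      intro x hx
      by_cases e : q = p
      · exact ih x fun q' hq' hF => hx q' hq' (by
          rw [Finset.mem_insert, not_or]
          exact ⟨fun h => hq' (h.trans e), hF⟩)
      obtain ⟨gq, hgq⟩ := hg q e
      obtain ⟨c, hc⟩ := H.exists_sub_mem q gq
      obtain ⟨n, y, hy⟩ := exists_pow_mul_mem_range hc x
      have hgc : algebraMap (R q) K (gq - algebraMap ℂ (R q) c) = g - algebraMap ℂ K c := by
        rw [map_sub, hgq, ← IsScalarTower.algebraMap_apply]
      rw [hgc] at hy
      have h1 : (g - algebraMap ℂ K c) ^ n * x ∈ ℂ⟮g⟯ := by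
        apply ih
        intro q' hq' hF
        by_cases e' : q' = q
        · subst e'
          exact ⟨y, hy⟩
        · refine mul_mem (pow_mem (sub_mem (hg q' hq') ?_) n) (hx q' hq' ?_)
          · exact ⟨algebraMap ℂ (R q') c, (IsScalarTower.algebraMap_apply _ _ _ _).symm⟩
          · rw [Finset.mem_insert, not_or]
            exact ⟨e', hF⟩
      have h2 : g - algebraMap ℂ K c ∈ ℂ⟮g⟯ := sub_mem hgmem (IntermediateField.algebraMap_mem _ c)
      have h3 : g - algebraMap ℂ K c ≠ 0 := by
        intro h
        apply notMem_range hw hwg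
        exact ⟨algebraMap ℂ (R p) c, by
          rw [← IsScalarTower.algebraMap_apply, sub_eq_zero.1 h]⟩
      have h4 := mul_mem (inv_mem (pow_mem h2 n)) h1
      rwa [inv_mul_cancel_left₀ (pow_ne_zero n h3)] at h4
  rw [eq_top_iff]
  intro x _
  exact key (H.finite x).toFinset x fun q _ hF => by
    by_contra hn
    exact hF ((H.finite x).mem_toFinset.2 hn)

omit hw hg hwg in
/-- The local rings of a Cousin family are germs of the line, whose coordinates generate the
field of functions. -/
theorem exists_isLineGerm (q : Q) : ∃ x : R q, IsLineGerm (R q) x ∧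
    ℂ⟮algebraMap (R q) K x⟯ = ⊤ ∧
    Function.Injective (aeval (algebraMap (R q) K x) : ℂ[X] → K) := by
  obtain ⟨g, w, hw, hg, hwg⟩ := H.exists_simple_pole q
  have htop := H.adjoin_eq_top hw hg hwg
  have hinj := injective_aeval hw hwg
  have hw' : w ∈ maximalIdeal (R q) := by
    rw [hw]
    exact Ideal.mem_span_singleton_self w
  have hw1 : algebraMap (R q) K w = g⁻¹ := eq_inv_of_mul_eq_one_left hwg
  have htop' : ℂ⟮algebraMap (R q) K w⟯ = ⊤ := by
    rw [hw1, eq_top_iff, ← htop, adjoin_simple_le_iff]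
    simpa using inv_mem (mem_adjoin_simple_self ℂ g⁻¹)
  have hinj' : Function.Injective (aeval (algebraMap (R q) K w) : ℂ[X] → K) := by
    rw [← transcendental_iff_injective] at hinj ⊢
    rw [hw1]
    intro h
    exact hinj (by simpa using h.inv)
  exact ⟨w, isLineGerm_of_adjoin_eq_top hw' htop' hinj', htop', hinj'⟩

end IsCousinFamily

/-! ### Models of the field of rational functions -/

open Polynomial IntermediateField

section AwayHom

variable {A K : Type} [CommRing A] [Algebra ℂ A] [Field K] [Algebra ℂ K]
  {f : A →ₐ[ℂ] K} (hf : Function.Injective f) {a : A} (ha : a ≠ 0)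

/-- The embedding of a localization of `A` in a field containing `A`. -/
def awayHom : Localization.Away a →ₐ[ℂ] K :=
  IsLocalization.liftAlgHom (M := Submonoid.powers a) (f := f) (by
    rintro ⟨_, n, rfl⟩
    rw [map_pow]
    exact (isUnit_iff_ne_zero.2 fun h => ha (hf (h.trans (map_zero f).symm))).pow n)

theorem mem_range_awayHom {y : K} :
    y ∈ (awayHom hf ha).range ↔ ∃ (n : ℕ) (c : A), y * f a ^ n = f c := by
  have hfa : f a ≠ 0 := fun h => ha (hf (h.trans (map_zero f).symm))
  have h1 (c : A) : awayHom hf ha (algebraMap A _ c) = f c := IsLocalization.lift_eq _ _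
  constructor
  · rintro ⟨z, rfl⟩
    obtain ⟨⟨c, ⟨_, n, rfl⟩⟩, e⟩ := IsLocalization.surj (Submonoid.powers a) z
    refine ⟨n, c, ?_⟩
    have := congrArg (awayHom hf ha) e
    rw [map_mul, h1, h1, map_pow] at this
    exact this
  · rintro ⟨n, c, e⟩
    refine ⟨IsLocalization.mk' _ c (⟨a ^ n, pow_mem (Submonoid.mem_powers a) n⟩ :
      Submonoid.powers a), ?_⟩
    have := congrArg (awayHom hf ha)
      (IsLocalization.mk'_spec (Localization.Away a) c
        (⟨a ^ n, pow_mem (Submonoid.mem_powers a) n⟩ : Submonoid.powers a))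
    rw [map_mul, h1, h1, map_pow, ← e] at this
    exact mul_right_cancel₀ (pow_ne_zero n hfa) this

theorem awayHom_injective : Function.Injective (awayHom hf ha) := by
  rw [injective_iff_map_eq_zero]
  intro z hz
  obtain ⟨⟨c, m⟩, e⟩ := IsLocalization.surj (Submonoid.powers a) z
  have := congrArg (awayHom hf ha) e
  rw [map_mul, hz, zero_mul] at this
  have h1 : awayHom hf ha (algebraMap A _ c) = f c := IsLocalization.lift_eq _ _
  have h2 : c = 0 := hf ((h1.symm.trans this.symm).trans (map_zero f).symm)
  rw [h2, map_zero] at e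
  exact (IsLocalization.map_units (Localization.Away a) m).mul_left_eq_zero.1 e

theorem apply_mem_range_awayHom (c : A) : f c ∈ (awayHom hf ha).range :=
  (mem_range_awayHom hf ha).2 ⟨0, c, by simp⟩

theorem inv_mem_range_awayHom : (f a)⁻¹ ∈ (awayHom hf ha).range :=
  (mem_range_awayHom hf ha).2 ⟨1, 1, by
    have hfa : f a ≠ 0 := fun h => ha (hf (h.trans (map_zero f).symm))
    simp [hfa]⟩

theorem range_awayHom_le {S : Subalgebra ℂ K} (h1 : ∀ c, f c ∈ S) (h2 : (f a)⁻¹ ∈ S) :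
    (awayHom hf ha).range ≤ S := by
  intro y hy
  have hfa : f a ≠ 0 := fun h => ha (hf (h.trans (map_zero f).symm))
  obtain ⟨n, c, e⟩ := (mem_range_awayHom hf ha).1 hy
  have : y = f c * (f a)⁻¹ ^ n := by
    rw [← e, mul_assoc, ← mul_pow, mul_inv_cancel₀ hfa, one_pow, mul_one]
  rw [this]
  exact mul_mem (h1 c) (pow_mem h2 n)

end AwayHom

/-- A finitely generated algebra with field of fractions `ℂ(x)` agrees with the polynomial ring
after inverting one element on each side. -/
theorem exists_away_algEquiv {B K : Type} [CommRing B] [IsDomain B] [Algebra ℂ B] [Field K]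
    [Algebra ℂ K] [Algebra B K] [IsScalarTower ℂ B K] [IsFractionRing B K]
    [Algebra.FiniteType ℂ B] (x : K) (htop : ℂ⟮x⟯ = ⊤)
    (hinj : Function.Injective (aeval x : ℂ[X] → K)) :
    ∃ (b : B) (v : ℂ[X]), b ≠ 0 ∧ v ≠ 0 ∧
      Nonempty (Localization.Away v ≃ₐ[ℂ] Localization.Away b) := by
  have hj : Function.Injective (IsScalarTower.toAlgHom ℂ B K) := IsFractionRing.injective B K
  set j := IsScalarTower.toAlgHom ℂ B K with hjdef
  set φ : ℂ[X] →ₐ[ℂ] K := aeval x with hφ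
  have hφ0 {P : ℂ[X]} (hP : P ≠ 0) : φ P ≠ 0 := fun h => hP (hinj (h.trans (map_zero φ).symm))
  have hj0 {c : B} (hc : c ≠ 0) : j c ≠ 0 := fun h => hc (hj (h.trans (map_zero j).symm))
  have hfrac (y : K) : ∃ P Q : ℂ[X], Q ≠ 0 ∧ y * φ Q = φ P := by
    have hy : y ∈ ℂ⟮x⟯ := by rw [htop]; trivial
    obtain ⟨P, Q, e⟩ := (mem_adjoin_simple_iff _ _).1 hy
    obtain rfl | hQ := eq_or_ne Q 0
    · exact ⟨0, 1, one_ne_zero, by simp [e]⟩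
    · exact ⟨P, Q, hQ, by rw [e]; exact div_mul_cancel₀ _ (hφ0 hQ)⟩
  obtain ⟨s, hs⟩ := Algebra.FiniteType.out (R := ℂ) (A := B)
  choose P Q hQ hPQ using fun c : B => hfrac (j c)
  set v₁ : ℂ[X] := ∏ c ∈ s, Q c with hv₁
  have hv₁0 : v₁ ≠ 0 := Finset.prod_ne_zero_iff.2 fun c _ => hQ c
  have hB (c : B) : j c ∈ (awayHom hinj hv₁0).range := by
    have : (⊤ : Subalgebra ℂ B) ≤ ((awayHom hinj hv₁0).range).comap j := by
      rw [← hs, Algebra.adjoin_le_iff]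
      intro c hc
      obtain ⟨R, hR⟩ := Finset.dvd_prod_of_mem Q hc
      refine (mem_range_awayHom hinj hv₁0).2 ⟨1, P c * R, ?_⟩
      change j c * φ v₁ ^ 1 = φ _
      rw [pow_one, hv₁, hR, map_mul, map_mul, ← mul_assoc, hPQ]
    exact this trivial
  obtain ⟨b₁, b₂, hb₂, hx⟩ := IsFractionRing.div_surjective (A := B) x
  have hb₂0 : b₂ ≠ 0 := nonZeroDivisors.ne_zero hb₂
  have hX (R : ℂ[X]) : φ R ∈ (awayHom hj hb₂0).range := by
    have : φ.range ≤ (awayHom hj hb₂0).range := by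
      rw [hφ, ← Algebra.adjoin_singleton_eq_range_aeval, Algebra.adjoin_le_iff,
        Set.singleton_subset_iff]
      refine (mem_range_awayHom hj hb₂0).2 ⟨1, b₁, ?_⟩
      rw [pow_one, ← hx]
      exact div_mul_cancel₀ _ (hj0 hb₂0)
    exact this ⟨R, rfl⟩
  obtain ⟨m, a, ha⟩ := (mem_range_awayHom hj hb₂0).1 (hX v₁)
  obtain ⟨k, w, hw⟩ := (mem_range_awayHom hinj hv₁0).1 (hB b₂)
  have hw : j b₂ * φ v₁ ^ k = φ w := hw
  have hv₁' := hφ0 hv₁0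
  have hb₂' := hj0 hb₂0
  have ha0 : a ≠ 0 := by
    rintro rfl
    rw [map_zero] at ha
    exact mul_ne_zero hv₁' (pow_ne_zero m hb₂') ha
  have hw0 : w ≠ 0 := by
    rintro rfl
    rw [map_zero] at hw
    exact mul_ne_zero hb₂' (pow_ne_zero k hv₁') hw
  have ha' := hj0 ha0
  have hw' := hφ0 hw0
  have hb0 : a * b₂ ≠ 0 := mul_ne_zero ha0 hb₂0
  have hv0 : v₁ * w ≠ 0 := mul_ne_zero hv₁0 hw0
  refine ⟨a * b₂, v₁ * w, hb0, hv0, ?_⟩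
  have hle₁ : (awayHom hinj hv0).range ≤ (awayHom hj hb0).range := by
    have hi := inv_mem_range_awayHom hj hb0
    have hi₁ : (j a)⁻¹ ∈ (awayHom hj hb0).range := by
      have := mul_mem hi (apply_mem_range_awayHom hj hb0 b₂)
      rwa [map_mul, mul_inv, mul_assoc, inv_mul_cancel₀ hb₂', mul_one] at this
    have hi₂ : (j b₂)⁻¹ ∈ (awayHom hj hb0).range := by
      have := mul_mem (apply_mem_range_awayHom hj hb0 a) hi
      rwa [map_mul, mul_inv, ← mul_assoc, mul_inv_cancel₀ ha', one_mul] at this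
    have hi₃ : (φ v₁)⁻¹ ∈ (awayHom hj hb0).range := by
      have := mul_mem (pow_mem (apply_mem_range_awayHom hj hb0 b₂) m) hi₁
      rw [← ha] at this
      convert this using 1
      field_simp
    have hle := range_awayHom_le hj hb₂0 (apply_mem_range_awayHom hj hb0) hi₂
    refine range_awayHom_le hinj hv0 (fun R => hle (hX R)) ?_
    have := mul_mem hi₃ (mul_mem hi₂ (pow_mem hi₃ k))
    convert this using 1
    change (φ (v₁ * w))⁻¹ = _
    rw [map_mul, ← hw, inv_pow]
    field_simp
  have hle₂ : (awayHom hj hb0).range ≤ (awayHom hinj hv0).range := by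
    have hap (R : ℂ[X]) : φ R ∈ (awayHom hinj hv0).range := apply_mem_range_awayHom hinj hv0 R
    have hi : (φ (v₁ * w))⁻¹ ∈ (awayHom hinj hv0).range := inv_mem_range_awayHom hinj hv0
    have hi₁ : (φ v₁)⁻¹ ∈ (awayHom hinj hv0).range := by
      have := mul_mem hi (hap w)
      rwa [map_mul, mul_inv, mul_assoc, inv_mul_cancel₀ hw', mul_one] at this
    have hi₂ : (φ w)⁻¹ ∈ (awayHom hinj hv0).range := by
      have := mul_mem (hap v₁) hi
      rwa [map_mul, mul_inv, ← mul_assoc, mul_inv_cancel₀ hv₁', one_mul] at this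
    have hi₃ : (j b₂)⁻¹ ∈ (awayHom hinj hv0).range := by
      have := mul_mem (pow_mem (hap v₁) k) hi₂
      rw [← hw] at this
      convert this using 1
      field_simp
    have hle := range_awayHom_le hinj hv₁0 hap hi₁
    refine range_awayHom_le hj hb0 (fun c => hle (hB c)) ?_
    have := mul_mem (mul_mem hi₁ (pow_mem hi₃ m)) hi₃
    convert this using 1
    rw [map_mul, ← ha, inv_pow]
    field_simp
  exact ⟨((AlgEquiv.ofInjective _ (awayHom_injective hinj hv0)).trans
    (Subalgebra.equivOfEq _ _ (le_antisymm hle₁ hle₂))).trans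
      (AlgEquiv.ofInjective _ (awayHom_injective hj hb0)).symm⟩

/-! ### Global functions on a connected reduced proper scheme -/

open Polynomial in
/-- The only global functions on a connected reduced proper complex scheme are the constants. -/
theorem scalars_surjective {X : Scheme.{0}} (s : X ⟶ Spec (.of ℂ)) [IsProper s] [IsReduced X]
    [ConnectedSpace X] : Function.Surjective (scalars s) := by
  intro f
  have hint : (scalars s).IsIntegral := by
    have := isIntegral_appTop_of_universallyClosed s
    exact RingHom.IsIntegral.trans _ _ (RingHom.isIntegral_of_surjective _
      (Scheme.ΓSpecIso (.of ℂ)).commRingCatIsoToRingEquiv.symm.surjective) this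
  obtain ⟨P, hP, hPf⟩ := hint f
  let g (c : ℂ) : Γ(X, ⊤) := f - scalars s c
  have hmem (x : X) (h : Γ(X, ⊤)) :
      x ∈ X.basicOpen h ↔ IsUnit ((X.presheaf.germ ⊤ x trivial).hom h) :=
    Scheme.mem_basicOpen (U := ⊤) _ h x trivial
  have hone (c d : ℂ) (h : c ≠ d) : X.basicOpen (g c) ⊔ X.basicOpen (g d) = ⊤ := by
    have hu : IsUnit (g d - g c) := by
      have : g d - g c = scalars s (c - d) := by simp [g]
      rw [this]
      exact (isUnit_iff_ne_zero.2 (sub_ne_zero.2 h)).map _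
    rw [eq_top_iff]
    intro x _
    rw [TopologicalSpace.Opens.mem_sup, hmem, hmem]
    by_contra! H
    have := (IsLocalRing.maximalIdeal (X.presheaf.stalk x)).sub_mem
      ((IsLocalRing.mem_maximalIdeal _).2 H.2) ((IsLocalRing.mem_maximalIdeal _).2 H.1)
    rw [← map_sub] at this
    exact (IsLocalRing.mem_maximalIdeal _).1 this (hu.map (X.presheaf.germ ⊤ x trivial).hom)
  have hprod : (P.roots.map g).prod = 0 := by
    have h1 := (IsAlgClosed.splits P).eq_prod_roots_of_monic hP
    have h2 := congrArg (eval₂ (scalars s) f) h1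
    rw [hPf, ← coe_eval₂RingHom, map_multiset_prod, Multiset.map_map] at h2
    rw [h2]
    congr 1
    refine Multiset.map_congr rfl fun c _ => ?_
    simp [g]
  have hcov (y : X) : ∃ d ∈ P.roots, y ∉ X.basicOpen (g d) := by
    by_contra! H
    have hu : IsUnit ((X.presheaf.germ ⊤ y trivial).hom (P.roots.map g).prod) := by
      rw [map_multiset_prod, Multiset.map_map]
      refine Multiset.prod_induction IsUnit _ (fun a b => IsUnit.mul) isUnit_one ?_
      intro z hz
      obtain ⟨d, hd, rfl⟩ := Multiset.mem_map.1 hz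
      exact (hmem _ _).1 (H d hd)
    rw [hprod, map_zero] at hu
    exact not_isUnit_zero hu
  obtain ⟨x⟩ : Nonempty X := inferInstance
  obtain ⟨c, -, hx⟩ := hcov x
  have hclopen : IsClopen ((X.basicOpen (g c) : Set X)ᶜ) := by
    refine ⟨(X.basicOpen (g c)).isOpen.isClosed_compl, ?_⟩
    have : ((X.basicOpen (g c) : Set X)ᶜ) =
        ⋂ d ∈ P.roots.toFinset.erase c, (X.basicOpen (g d) : Set X) := by
      ext y
      simp only [Set.mem_compl_iff, Set.mem_iInter, SetLike.mem_coe, Finset.mem_erase,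
        Multiset.mem_toFinset]
      constructor
      · rintro hy d ⟨hdc, -⟩
        have : y ∈ X.basicOpen (g d) ⊔ X.basicOpen (g c) := by rw [hone d c hdc]; trivial
        exact (TopologicalSpace.Opens.mem_sup.1 this).resolve_right hy
      · intro hy hyc
        obtain ⟨d, hd, hyd⟩ := hcov y
        obtain rfl | hdc := eq_or_ne d c
        · exact hyd hyc
        · exact hyd (hy d ⟨hdc, hd⟩)
    rw [this]
    exact isOpen_biInter_finset fun d _ => (X.basicOpen (g d)).isOpen
  have htop := hclopen.eq_univ ⟨x, hx⟩
  have hbot : X.basicOpen (g c) = ⊥ := by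
    ext y
    have : y ∈ ((X.basicOpen (g c) : Set X)ᶜ) := by rw [htop]; trivial
    exact ⟨fun h => (this h).elim, fun h => h.elim⟩
  have := (basicOpen_eq_bot_iff (g c)).1 hbot
  exact ⟨c, (sub_eq_zero.1 this).symm⟩

/-! ### Noetherian spaces of dimension one -/

section Topology

variable {X : Type} [TopologicalSpace X]

theorem isClosed_singleton_of_notMem_genericPoints [T0Space X]
    (hdim : topologicalKrullDim X ≤ 1) {x : X} (hx : x ∉ genericPoints X) :
    IsClosed ({x} : Set X) := by
  by_contra hcl
  obtain ⟨y, hy, hyx⟩ : ∃ y ∈ closure {x}, y ≠ x := by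
    by_contra! H
    refine hcl (closure_subset_iff_isClosed.1 fun y hy => H y hy)
  obtain ⟨W, hW, hxW⟩ := exists_preirreducible ({x} : Set X) isIrreducible_singleton.2
  have hWirr : IsIrreducible W := ⟨⟨x, hxW.1 rfl⟩, hW⟩
  have hWcl : IsClosed W := by
    rw [← closure_subset_iff_isClosed, hxW.2 _ hW.closure subset_closure]
  let a : IrreducibleCloseds X := ⟨closure {y}, isIrreducible_singleton.closure, isClosed_closure⟩
  let b : IrreducibleCloseds X := ⟨closure {x}, isIrreducible_singleton.closure, isClosed_closure⟩
  let c : IrreducibleCloseds X := ⟨W, hWirr, hWcl⟩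
  have hab : a < b := by
    refine lt_of_le_of_ne (closure_minimal (Set.singleton_subset_iff.2 hy)
      isClosed_closure) fun h => hyx ?_
    have : closure {y} = closure {x} := congrArg (fun z : IrreducibleCloseds X => (z : Set X)) h
    exact (inseparable_iff_closure_eq.2 this).eq
  have hbc : b < c := by
    refine lt_of_le_of_ne (closure_minimal (Set.singleton_subset_iff.2 (hxW.1 rfl))
      hWcl) fun h => hx ?_
    have : closure {x} = W := congrArg (fun z : IrreducibleCloseds X => (z : Set X)) h
    change closure {x} ∈ irreducibleComponents X
    rw [this]
    exact ⟨hWirr, fun T hT h => (hxW.2 T hT.2 h).le⟩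
  exact (Order.krullDim_le_one_iff.1 hdim b).elim (fun h => h.not_lt hab) fun h => h.not_lt hbc

theorem finite_of_isClosed_of_disjoint_genericPoints [T0Space X] [QuasiSober X] [NoetherianSpace X]
    (hdim : topologicalKrullDim X ≤ 1) {T : Set X} (hT : IsClosed T)
    (hd : ∀ x ∈ T, x ∉ genericPoints X) : T.Finite := by
  obtain ⟨S, hS, hScl, hSirr, rfl⟩ := NoetherianSpace.exists_finite_set_isClosed_irreducible hT
  refine hS.sUnion fun Z hZ => ?_
  obtain ⟨z, hz⟩ := QuasiSober.sober (hSirr Z hZ) (hScl Z hZ)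
  have h1 := isClosed_singleton_of_notMem_genericPoints hdim
    (hd z (Set.subset_sUnion_of_mem hZ hz.mem))
  rw [← hz.def, h1.closure_eq]
  exact Set.finite_singleton z

theorem not_isClosed_singleton_of_mem_genericPoints [NoetherianSpace X]
    [ConnectedSpace X] (hdim : topologicalKrullDim X = 1) {x : X} (hx : x ∈ genericPoints X) :
    ¬ IsClosed ({x} : Set X) := by
  intro hcl
  have hx : closure {x} ∈ irreducibleComponents X := hx
  rw [hcl.closure_eq] at hx
  have hfin : ({Z ∈ irreducibleComponents X | x ∉ Z}).Finite :=
    NoetherianSpace.finite_irreducibleComponents.subset fun _ h => h.1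
  have h1 : ({x} : Set X)ᶜ = ⋃₀ {Z ∈ irreducibleComponents X | x ∉ Z} := by
    ext y
    constructor
    · intro hy
      refine ⟨irreducibleComponent y, ⟨irreducibleComponent_mem_irreducibleComponents y,
        fun hxy => hy ?_⟩, mem_irreducibleComponent⟩
      exact hx.2 isIrreducible_irreducibleComponent (by simpa using hxy) mem_irreducibleComponent
    · rintro ⟨Z, ⟨-, hxZ⟩, hyZ⟩ rfl
      exact hxZ hyZ
  have h2 : IsClosed (({x} : Set X)ᶜ) := by
    rw [h1, Set.sUnion_eq_biUnion]
    exact hfin.isClosed_biUnion fun Z hZ => isClosed_of_mem_irreducibleComponents Z hZ.1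
  have h3 : ({x} : Set X) = Set.univ :=
    IsClopen.eq_univ ⟨hcl, isClosed_compl_iff.1 h2⟩ ⟨x, rfl⟩
  have h4 : topologicalKrullDim X ≤ 0 := by
    have : Subsingleton (IrreducibleCloseds X) := ⟨fun a b => by
      have key (a : IrreducibleCloseds X) : (a : Set X) = {x} := by
        refine (Set.Nonempty.subset_singleton_iff a.2.nonempty).1 ?_
        rw [h3]
        exact Set.subset_univ _
      exact SetLike.coe_injective ((key a).trans (key b).symm)⟩
    exact Order.krullDim_nonpos_of_subsingleton
  rw [hdim] at h4
  norm_cast at h4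

end Topology

/-! ### Sections with a prescribed principal part -/

/-- An additive Cousin problem: on a curve with `H¹(𝒪) = 0`, rational functions can be prescribed
at a closed point `p`, modulo functions regular at `p`, by a function that is regular elsewhere. -/
theorem exists_germ_add_stalkSpecializes_eq (X : Scheme.{0}) [NoetherianSpace X]
    [Subsingleton (structureCohomology X 1)] (hdim : topologicalKrullDim X ≤ 1) {p : X}
    (U : X.Opens) (hU : ∀ x, x ∈ U ↔ x ≠ p) (hp : ∀ η : genericPoints X, η.1 ∈ U)
    (φ : ∀ η : genericPoints X, X.presheaf.stalk η.1) :
    ∃ (g : Γ(X, U)) (h : X.presheaf.stalk p), ∀ (η : genericPoints X) (hη : η.1 ⤳ p),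
      X.presheaf.germ U η.1 (hp η) g + X.presheaf.stalkSpecializes hη h = φ η := by
  have hfin : Finite (genericPoints X) :=
    genericPoints.finite NoetherianSpace.finite_irreducibleComponents
  have hcl (η : genericPoints X) :
      IsClosed (⋃ (η' : genericPoints X) (_ : η' ≠ η), closure {η'.1}) :=
    isClosed_iUnion_of_finite fun _ => isClosed_iUnion_of_finite fun _ => isClosed_closure
  let N (η : genericPoints X) : X.Opens :=
    ⟨(⋃ (η' : genericPoints X) (_ : η' ≠ η), closure {η'.1})ᶜ, (hcl η).isOpen_compl⟩
  have hN (η : genericPoints X) (y : X) :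
      y ∈ N η ↔ ∀ η' : genericPoints X, y ∈ closure {η'.1} → η' = η := by
    change ¬ _ ↔ _
    simp only [Set.mem_iUnion, not_exists]
    exact forall_congr' fun η' => ⟨fun h h' => by_contra fun h'' => h h'' h',
      fun h h' h'' => h' (h h'')⟩
  have hηN (η : genericPoints X) : η.1 ∈ N η := by
    refine (hN η _).2 fun η' h => ?_
    have h1 : closure {η.1} ⊆ closure {η'.1} :=
      closure_minimal (Set.singleton_subset_iff.2 h) isClosed_closure
    have h2 : closure {η'.1} ⊆ closure {η.1} :=
      η.2.2 isIrreducible_singleton.closure h1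
    exact genericPoints.component_injective (Subtype.ext (h2.antisymm h1))
  have hdisj (η η' : genericPoints X) (h : η ≠ η') (y : X) (h1 : y ∈ N η) (h2 : y ∈ N η') :
      False := by
    let ζ := genericPoints.ofComponent
      ⟨_, irreducibleComponent_mem_irreducibleComponents y⟩
    have hy : y ∈ closure {ζ.1} := by
      rw [(genericPoints.isGenericPoint_ofComponent
        ⟨_, irreducibleComponent_mem_irreducibleComponents y⟩).def]
      exact mem_irreducibleComponent
    exact h (((hN _ _).1 h1 ζ hy).symm.trans ((hN _ _).1 h2 ζ hy))
  choose W hWN hηW t ht using fun η : genericPoints X =>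
    X.presheaf.exists_le_germ_eq (φ η) (hηN η)
  have hcomp : TopCat.Presheaf.IsCompatible X.presheaf W t := by
    intro η η'
    by_cases h : η = η'
    · subst h
      rfl
    · have : W η ⊓ W η' = ⊥ := by
        ext y
        exact ⟨fun hy => (hdisj η η' h y (hWN _ hy.1) (hWN _ hy.2)).elim, fun hy => hy.elim⟩
      have : Subsingleton Γ(X, W η ⊓ W η') :=
        CommRingCat.subsingleton_of_isTerminal (X.sheaf.isTerminalOfEqEmpty this)
      exact this.elim _ _
  obtain ⟨f, hf, -⟩ := X.sheaf.existsUnique_gluing W t hcomp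
  let T : Set X := ((iSup W : X.Opens) : Set X)ᶜ
  have hT (x : X) (hx : x ∈ T) : x ∉ genericPoints X := fun h =>
    hx (TopologicalSpace.Opens.mem_iSup.2 ⟨⟨x, h⟩, hηW ⟨x, h⟩⟩)
  have hTfin : T.Finite :=
    finite_of_isClosed_of_disjoint_genericPoints hdim (iSup W : X.Opens).isOpen.isClosed_compl hT
  have hTcl : IsClosed (T \ {p}) := by
    rw [← Set.biUnion_of_singleton (T \ {p})]
    exact (hTfin.subset Set.sdiff_subset).isClosed_biUnion fun x hx =>
      isClosed_singleton_of_notMem_genericPoints hdim (hT x hx.1)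
  let V : X.Opens := ⟨(T \ {p})ᶜ, hTcl.isOpen_compl⟩
  have hpV : p ∈ V := fun h => h.2 rfl
  have hUV : U ⊔ V = ⊤ := by
    rw [eq_top_iff]
    intro x _
    obtain rfl | hx := eq_or_ne x p
    · exact TopologicalSpace.Opens.mem_sup.2 (Or.inr hpV)
    · exact TopologicalSpace.Opens.mem_sup.2 (Or.inl ((hU x).2 hx))
  have hle : U ⊓ V ≤ iSup W := fun x hx => by_contra fun h => hx.2 ⟨h, (hU x).1 hx.1⟩
  obtain ⟨a, b, hab⟩ := exists_add_of_subsingleton_structureCohomology X U V hUV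
    (X.presheaf.map (homOfLE hle).op f)
  refine ⟨a, X.presheaf.germ V p hpV b, fun η hη => ?_⟩
  have hηV : η.1 ∈ V := hη.mem_open V.isOpen hpV
  rw [← ht η, ← hf η, ← ConcreteCategory.comp_apply, X.presheaf.germ_stalkSpecializes]
  have := congrArg (X.presheaf.germ (U ⊓ V) η.1 ⟨hp η, hηV⟩).hom hab
  rw [map_add] at this
  erw [X.presheaf.germ_res_apply, X.presheaf.germ_res_apply, X.presheaf.germ_res_apply] at this
  rw [this]
  exact (X.presheaf.germ_res_apply (Opens.leSupr W η) η.1 (hηW η) f).symm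

/-! ### Local rings of complex schemes -/

section Stalks

variable (Z : Scheme.{0}) [Z.Over (Spec (.of ℂ))]

/-- The complex algebra structure on the local rings of a complex scheme. -/
instance stalkAlgebra (z : Z) : Algebra ℂ (Z.presheaf.stalk z) :=
  ((Z.presheaf.germ ⊤ z trivial).hom.comp (scalars (Z ↘ Spec (.of ℂ)))).toAlgebra

theorem fromSpecStalk_over (z : Z) : Z.fromSpecStalk z ≫ (Z ↘ Spec (.of ℂ)) =
    Spec.map (CommRingCat.ofHom (algebraMap ℂ (Z.presheaf.stalk z))) := by
  rw [← cancel_mono (Spec (.of ℂ)).toSpecΓ, Category.assoc, Scheme.toSpecΓ_naturality,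
    ← Category.assoc, Scheme.fromSpecStalk_toSpecΓ, ← Spec.map_comp,
    ← SpecMap_ΓSpecIso_hom, ← Spec.map_comp]
  congr 1
  have : CommRingCat.ofHom (algebraMap ℂ (Z.presheaf.stalk z)) =
    (Scheme.ΓSpecIso (.of ℂ)).inv ≫ (Z ↘ Spec (.of ℂ)).appTop ≫
      Z.presheaf.germ ⊤ z trivial := rfl
  rw [this, Iso.hom_inv_id_assoc]

variable {Z}

theorem stalkSpecializes_algebraMap {x y : Z} (h : x ⤳ y) (c : ℂ) :
    Z.presheaf.stalkSpecializes h (algebraMap ℂ (Z.presheaf.stalk y) c) =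
      algebraMap ℂ (Z.presheaf.stalk x) c := by
  exact ConcreteCategory.congr_hom (Z.presheaf.germ_stalkSpecializes (U := ⊤) trivial h)
    (scalars (Z ↘ Spec (.of ℂ)) c)

theorem exists_sub_algebraMap_mem_maximalIdeal [LocallyOfFiniteType (Z ↘ Spec (.of ℂ))] {z : Z}
    (hz : IsClosed {z}) (a : Z.presheaf.stalk z) :
    ∃ c : ℂ, a - algebraMap ℂ (Z.presheaf.stalk z) c ∈ maximalIdeal (Z.presheaf.stalk z) := by
  obtain ⟨σ, hσ, rfl⟩ : ∃ σ : Spec (.of ℂ) ⟶ Z, σ ≫ (Z ↘ Spec (.of ℂ)) = 𝟙 _ ∧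
      σ (closedPoint ℂ) = z :=
    ⟨pointOfClosedPoint (Z ↘ Spec (.of ℂ)) z hz, pointOfClosedPoint_comp _ _ _,
      pointOfClosedPoint_apply _ _ _ _⟩
  have h := Scheme.Spec_stalkClosedPointTo_fromSpecStalk σ
  have h1 : CommRingCat.ofHom (algebraMap ℂ (Z.presheaf.stalk (σ (closedPoint ℂ)))) ≫
      Scheme.stalkClosedPointTo σ = 𝟙 _ := by
    apply Spec.map_injective
    rw [Spec.map_comp, ← fromSpecStalk_over, ← Category.assoc, h, hσ, Spec.map_id]
  refine ⟨Scheme.stalkClosedPointTo σ a, (mem_maximalIdeal _).2 fun hu => ?_⟩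
  have h2 := hu.map (Scheme.stalkClosedPointTo σ).hom
  have h3 : (Scheme.stalkClosedPointTo σ).hom (algebraMap ℂ _ (Scheme.stalkClosedPointTo σ a)) =
      Scheme.stalkClosedPointTo σ a :=
    ConcreteCategory.congr_hom h1 (Scheme.stalkClosedPointTo σ a)
  rw [map_sub, h3] at h2
  exact not_isUnit_zero ((sub_self (Scheme.stalkClosedPointTo σ a)).symm ▸ h2)

end Stalks

section FunctionField

theorem finite_notMem_range (Z : Scheme.{0}) [IsIntegral Z] [NoetherianSpace Z]
    (hdim : topologicalKrullDim Z ≤ 1) (x : Z.functionField) : {q : {z : Z // z ≠ genericPoint Z} |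
      x ∉ (algebraMap (Z.presheaf.stalk q.1) Z.functionField).range}.Finite := by
  obtain ⟨U, hU, f, rfl⟩ := Z.presheaf.exists_germ_eq x
  have hT : ((U : Set Z)ᶜ).Finite := by
    refine finite_of_isClosed_of_disjoint_genericPoints hdim U.isOpen.isClosed_compl ?_
    rw [genericPoints_eq_singleton]
    rintro z hz rfl
    exact hz hU
  refine (hT.preimage Subtype.val_injective.injOn).subset fun q hq hqU => hq ?_
  exact ⟨Z.presheaf.germ U q.1 hqU f, ConcreteCategory.congr_hom
    (Z.presheaf.germ_stalkSpecializes hqU ((genericPoint_spec Z).specializes trivial)) f⟩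

variable {Z : Scheme.{0}} [IsIntegral Z]

theorem isClosed_singleton_of_ne_genericPoint (hdim : topologicalKrullDim Z ≤ 1)
    {z : Z} (hz : z ≠ genericPoint Z) : IsClosed ({z} : Set Z) :=
  isClosed_singleton_of_notMem_genericPoints hdim (by rwa [genericPoints_eq_singleton])

theorem not_isField_stalk {z : Z} (hz : z ≠ genericPoint Z) :
    ¬ IsField (Z.presheaf.stalk z) := by
  intro h
  obtain ⟨P, hP⟩ : genericPoint Z ∈ Set.range (Z.fromSpecStalk z) := by
    rw [Scheme.range_fromSpecStalk]
    exact (genericPoint_spec Z).specializes trivial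
  have := PrimeSpectrum.subsingleton_iff_isField_of_isReduced.2 h
  have hPc : P = closedPoint _ := Subsingleton.elim (α := PrimeSpectrum (Z.presheaf.stalk z)) _ _
  rw [hPc, Scheme.fromSpecStalk_closedPoint] at hP
  exact hz hP

theorem eq_maximalIdeal_of_ne_bot (hdim : topologicalKrullDim Z ≤ 1) {z : Z}
    (P : Ideal (Z.presheaf.stalk z)) (hP : P ≠ ⊥) (hP' : P.IsPrime) :
    P = maximalIdeal (Z.presheaf.stalk z) := by
  let f := Z.fromSpecStalk z
  have hf : Function.Injective f := f.isEmbedding.injective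
  let y : Spec (Z.presheaf.stalk z) := (⟨P, hP'⟩ : PrimeSpectrum _)
  have hy : f y ⤳ z := by
    have : f y ∈ Set.range (Z.fromSpecStalk z) := ⟨y, rfl⟩
    rwa [Scheme.range_fromSpecStalk] at this
  obtain h | h := eq_or_ne (f y) (genericPoint Z)
  · refine (hP ?_).elim
    let b : Spec (Z.presheaf.stalk z) := (⊥ : PrimeSpectrum (Z.presheaf.stalk z))
    have hb : b ⤳ y := (PrimeSpectrum.le_iff_specializes _ _).1
      (bot_le (a := (⟨P, hP'⟩ : PrimeSpectrum (Z.presheaf.stalk z))))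
    have hfb : f b = genericPoint Z :=
      ((hb.map f.continuous).trans (h ▸ specializes_rfl)).antisymm
        ((genericPoint_spec Z).specializes trivial) |>.eq
    exact (congrArg PrimeSpectrum.asIdeal (hf (hfb.trans h.symm))).symm
  · have h1 := isClosed_singleton_of_ne_genericPoint hdim h
    have h2 : f y = z := (h1.closure_eq ▸ hy.mem_closure : z ∈ ({f y} : Set Z)).symm
    exact congrArg PrimeSpectrum.asIdeal (hf (h2.trans Scheme.fromSpecStalk_closedPoint.symm))

variable (Z) [Z.Over (Spec (.of ℂ))]

instance (z : Z) : IsScalarTower ℂ (Z.presheaf.stalk z) Z.functionField :=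
  .of_algebraMap_eq fun c => (stalkSpecializes_algebraMap _ c).symm

theorem eq_const_of_forall_isIntegral [IsProper (Z ↘ Spec (.of ℂ))] (x : Z.functionField)
    (hx : ∀ z ≠ genericPoint Z, IsIntegral (Z.presheaf.stalk z) x) :
    ∃ c : ℂ, algebraMap ℂ Z.functionField c = x := by
  have hx' (z : Z) : IsIntegral (Z.presheaf.stalk z) x := by
    obtain rfl | hz := eq_or_ne z (genericPoint Z)
    · refine ⟨Polynomial.X - Polynomial.C x, Polynomial.monic_X_sub_C x, ?_⟩
      rw [Polynomial.eval₂_sub, Polynomial.eval₂_X, Polynomial.eval₂_C, sub_eq_zero]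
      exact (ConcreteCategory.congr_hom (Z.presheaf.stalkSpecializes_refl _) x).symm
    · exact hx z hz
  have hmem : x ∈ (integralClosure (Subring.closure
      (Set.range (algebraMap ℂ Z.functionField))) Z.functionField).toSubring := by
    rw [← iInf_valuationSubring_superset, Subring.mem_iInf]
    rintro ⟨O, hO⟩
    let φ : ℂ →+* O := (algebraMap ℂ Z.functionField).codRestrict O.toSubring fun c => hO ⟨c, rfl⟩
    let incl : CommRingCat.of O ⟶ Z.functionField :=
      CommRingCat.ofHom (algebraMap O Z.functionField)
    have hsq : Z.fromSpecStalk (genericPoint Z) ≫ (Z ↘ Spec (.of ℂ)) =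
        Spec.map incl ≫ Spec.map (CommRingCat.ofHom φ) := by
      rw [fromSpecStalk_over, ← Spec.map_comp]
      rfl
    have hval : ValuativeCriterion.Existence (Z ↘ Spec (.of ℂ)) := by
      have h : UniversallyClosed (Z ↘ Spec (.of ℂ)) := inferInstance
      rw [UniversallyClosed.eq_valuativeCriterion] at h
      exact h.1
    obtain ⟨l, hl, -⟩ :=
      (hval { R := O, K := Z.functionField, commSq := ⟨hsq⟩, .. }).exists_lift
    have hl : Spec.map incl ≫ l = Z.fromSpecStalk (genericPoint Z) := hl
    set z := l (closedPoint O)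
    let ψ : Z.presheaf.stalk z ⟶ CommRingCat.of O := Scheme.stalkClosedPointTo l
    have hψ : ψ ≫ incl = CommRingCat.ofHom (algebraMap (Z.presheaf.stalk z) Z.functionField) := by
      apply Spec.map_injective
      rw [← cancel_mono (Z.fromSpecStalk z), Spec.map_comp, Category.assoc,
        Scheme.Spec_stalkClosedPointTo_fromSpecStalk, hl]
      exact (Scheme.SpecMap_stalkSpecializes_fromSpecStalk
        ((genericPoint_spec Z).specializes trivial)).symm
    obtain ⟨P, hP, hPx⟩ := hx' z
    have hO : IsIntegral O x := by
      refine ⟨P.map ψ.hom, hP.map _, ?_⟩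
      rw [Polynomial.eval₂_map, ← hPx]
      exact congrArg (fun f => Polynomial.eval₂ f x P) (congrArg CommRingCat.Hom.hom hψ)
    obtain ⟨y, rfl⟩ := IsIntegrallyClosed.isIntegral_iff.1 hO
    exact y.2
  have hint : IsIntegral ℂ x := by
    obtain ⟨P, hP, hPx⟩ := hmem
    have hlift : P.map (algebraMap _ Z.functionField) ∈
        Polynomial.lifts (algebraMap ℂ Z.functionField) := by
      rw [Polynomial.lifts_iff_coeff_lifts]
      intro n
      rw [Polynomial.coeff_map]
      have : Subring.closure (Set.range (algebraMap ℂ Z.functionField)) ≤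
          (algebraMap ℂ Z.functionField).range := Subring.closure_le.2 subset_rfl
      exact this (P.coeff n).2
    obtain ⟨R, hR, -, hRm⟩ := Polynomial.lifts_and_natDegree_eq_and_monic hlift (hP.map _)
    refine ⟨R, hRm, ?_⟩
    rw [Polynomial.eval₂_eq_eval_map, hR, ← Polynomial.eval₂_eq_eval_map]
    exact hPx
  exact minpoly.mem_range_of_degree_eq_one ℂ x
    (IsAlgClosed.degree_eq_one_of_irreducible ℂ (minpoly.irreducible hint))

theorem isCousinFamily_stalk [IsProper (Z ↘ Spec (.of ℂ))] [NoetherianSpace Z]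
    (hdim : topologicalKrullDim Z ≤ 1)
    (H : ∀ (q : {z : Z // z ≠ genericPoint Z}) (x : Z.functionField),
      ∃ g : Z.functionField, (∀ q' : {z : Z // z ≠ genericPoint Z}, q' ≠ q →
        g ∈ (algebraMap (Z.presheaf.stalk q'.1) Z.functionField).range) ∧
      ∃ h : Z.presheaf.stalk q.1, g + algebraMap (Z.presheaf.stalk q.1) Z.functionField h = x) :
    IsCousinFamily Z.functionField
      fun q : {z : Z // z ≠ genericPoint Z} => Z.presheaf.stalk q.1 where
  not_isField q := not_isField_stalk q.2
  eq_maximalIdeal _ := eq_maximalIdeal_of_ne_bot hdim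
  exists_sub_mem q :=
    exists_sub_algebraMap_mem_maximalIdeal (isClosed_singleton_of_ne_genericPoint hdim q.2)
  finite := finite_notMem_range Z hdim
  eq_const x hx := eq_const_of_forall_isIntegral Z x fun z hz => hx ⟨z, hz⟩
  exists_add := H

end FunctionField

/-! ### Components of a curve -/

section Reduced

variable (X : Scheme.{0}) (Z : Closeds X)

instance : IsClosedImmersion (reducedSubschemeι X Z) :=
  inferInstanceAs (IsClosedImmersion (Scheme.IdealSheafData.vanishingIdeal Z).subschemeι)

theorem range_reducedSubschemeι : Set.range (reducedSubschemeι X Z) = Z := by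
  exact (Scheme.IdealSheafData.range_subschemeι _).trans
    (Scheme.IdealSheafData.coe_support_vanishingIdeal _)

instance : IsReduced (reducedSubscheme X Z) := by
  let I := Scheme.IdealSheafData.vanishingIdeal Z
  have (U : I.subschemeCover.openCover.I₀) : IsReduced (I.subschemeCover.openCover.X U) := by
    let U : X.affineOpens := U
    have : _root_.IsReduced (Γ(X, U) ⧸ I.ideal U) := by
      rw [← Ideal.isRadical_iff_quotient_reduced, Scheme.IdealSheafData.vanishingIdeal_ideal]
      exact PrimeSpectrum.isRadical_vanishingIdeal _
    exact inferInstanceAs (IsReduced (Spec (.of (Γ(X, U) ⧸ I.ideal U))))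
  exact IsReduced.of_openCover _ I.subschemeCover.openCover

variable {X Z} in
theorem isIntegral_reducedSubscheme (hZ : IsIrreducible (Z : Set X)) :
    IsIntegral (reducedSubscheme X Z) := by
  have : IrreducibleSpace (reducedSubscheme X Z) := Subtype.irreducibleSpace (s := (Z : Set X)) hZ
  exact isIntegral_of_irreducibleSpace_of_isReduced _

end Reduced

section Component

variable {C Z : Scheme.{0}} [C.Over (Spec (.of ℂ))] [Z.Over (Spec (.of ℂ))] (i : Z ⟶ C)
  [i.IsOver (Spec (.of ℂ))]

theorem stalkMap_algebraMap (z : Z) (c : ℂ) :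
    i.stalkMap z (algebraMap ℂ (C.presheaf.stalk (i z)) c) =
      algebraMap ℂ (Z.presheaf.stalk z) c := by
  have h : CommRingCat.ofHom (algebraMap ℂ (C.presheaf.stalk (i z))) ≫ i.stalkMap z =
      CommRingCat.ofHom (algebraMap ℂ (Z.presheaf.stalk z)) := by
    apply Spec.map_injective
    rw [Spec.map_comp, ← fromSpecStalk_over, ← fromSpecStalk_over, ← Category.assoc,
      Scheme.SpecMap_stalkMap_fromSpecStalk, Category.assoc, (Scheme.Hom.isOver_iff _).1 ‹_›]
  exact ConcreteCategory.congr_hom h c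

/-- The homomorphism of local rings of a morphism at a point specializing to a given one. -/
def stalkHom (q : Z) {p : C} (h : i q ⤳ p) : C.presheaf.stalk p →ₐ[ℂ] Z.presheaf.stalk q where
  __ := (C.presheaf.stalkSpecializes h ≫ i.stalkMap q).hom
  commutes' c := by
    change i.stalkMap q (C.presheaf.stalkSpecializes h (algebraMap ℂ _ c)) = _
    rw [stalkSpecializes_algebraMap, stalkMap_algebraMap]

theorem stalkHom_apply (q : Z) {p : C} (h : i q ⤳ p) (a : C.presheaf.stalk p) :
    stalkHom i q h a = i.stalkMap q (C.presheaf.stalkSpecializes h a) := rfl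

theorem stalkHom_rfl (q : Z) (a : C.presheaf.stalk (i q)) :
    stalkHom i q specializes_rfl a = i.stalkMap q a := by
  rw [stalkHom_apply]
  exact congrArg _ (ConcreteCategory.congr_hom (C.presheaf.stalkSpecializes_refl _) a)

theorem stalkHom_stalkSpecializes (q : Z) {p p' : C} (h : i q ⤳ p) (h' : p ⤳ p')
    (a : C.presheaf.stalk p') :
    stalkHom i q h (C.presheaf.stalkSpecializes h' a) = stalkHom i q (h.trans h') a := by
  rw [stalkHom_apply, stalkHom_apply]
  exact congrArg _ (C.presheaf.stalkSpecializes_comp_apply _ _ _)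

theorem stalkHom_germ (q : Z) {p : C} (h : i q ⤳ p) {U : C.Opens} (hp : p ∈ U) (g : Γ(C, U)) :
    stalkHom i q h (C.presheaf.germ U p hp g) =
      i.stalkMap q (C.presheaf.germ U (i q) (h.mem_open U.isOpen hp) g) :=
  congrArg (i.stalkMap q) (ConcreteCategory.congr_hom (C.presheaf.germ_stalkSpecializes hp h) g)

theorem stalkSpecializes_stalkHom {q q' : Z} (h' : q' ⤳ q) {p : C} (h : i q ⤳ p)
    (a : C.presheaf.stalk p) : Z.presheaf.stalkSpecializes h' (stalkHom i q h a) =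
      stalkHom i q' ((h'.map i.continuous).trans h) a := by
  rw [stalkHom_apply, stalkHom_apply]
  exact (i.stalkSpecializes_stalkMap_apply q' q h' (C.presheaf.stalkSpecializes h a)).symm.trans
    (congrArg (i.stalkMap q') (C.presheaf.stalkSpecializes_comp_apply _ _ _))

variable [IsClosedImmersion i]

theorem stalkHom_surjective (q : Z) {p : C} (h : i q = p) :
    Function.Surjective (stalkHom i q (specializes_of_eq h)) := by
  subst h
  intro x
  obtain ⟨y, rfl⟩ := i.stalkMap_surjective _ x
  exact ⟨y, stalkHom_rfl i q y⟩

variable [IsIntegral Z]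

omit [C.Over (Spec (.of ℂ))] [Z.Over (Spec (.of ℂ))] [i.IsOver (Spec (.of ℂ))] in
theorem apply_notMem_genericPoints {z : Z} (hz : z ≠ genericPoint Z) : i z ∉ genericPoints C := by
  intro h
  have hs : i (genericPoint Z) ⤳ i z :=
    ((genericPoint_spec Z).specializes trivial).map i.continuous
  have h1 : closure {i z} ⊆ closure {i (genericPoint Z)} :=
    closure_minimal (Set.singleton_subset_iff.2 hs.mem_closure) isClosed_closure
  have h2 := h1.antisymm (h.2 isIrreducible_singleton.closure h1)
  exact hz (i.isEmbedding.injective (inseparable_iff_closure_eq.2 h2).eq)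

omit [IsClosedImmersion i] in
theorem algebraMap_stalkHom (q : Z) {p : C} (h : i q ⤳ p) (a : C.presheaf.stalk p) :
    algebraMap (Z.presheaf.stalk q) Z.functionField (stalkHom i q h a) =
      stalkHom i (genericPoint Z)
        ((((genericPoint_spec Z).specializes trivial).map i.continuous).trans h) a :=
  stalkSpecializes_stalkHom i _ h a

omit [IsClosedImmersion i] in
theorem stalkHom_germ_mem_range {U : C.Opens} (g : Γ(C, U)) {η : C} (hη : η ∈ U)
    (h : i (genericPoint Z) ⤳ η) {q : Z} (hq : i q ∈ U) :
    stalkHom i (genericPoint Z) h (C.presheaf.germ U η hη g) ∈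
      (algebraMap (Z.presheaf.stalk q) Z.functionField).range := by
  refine ⟨stalkHom i q specializes_rfl (C.presheaf.germ U _ hq g), ?_⟩
  rw [algebraMap_stalkHom, stalkHom_germ, stalkHom_germ]
omit [C.Over (Spec (.of ℂ))] [Z.Over (Spec (.of ℂ))] [i.IsOver (Spec (.of ℂ))] in
theorem exists_ne_genericPoint [NoetherianSpace C] [ConnectedSpace C]
    (hdim : topologicalKrullDim C = 1) (hη : i (genericPoint Z) ∈ genericPoints C) :
    ∃ z : Z, z ≠ genericPoint Z := by
  by_contra! H
  refine not_isClosed_singleton_of_mem_genericPoints hdim hη ?_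
  convert i.isClosedEmbedding.isClosed_range using 1
  refine ((Set.range_nonempty _).subset_singleton_iff.1 ?_).symm
  rintro _ ⟨z, rfl⟩
  rw [H z]
  rfl

variable [NoetherianSpace C] [Subsingleton (structureCohomology C 1)]
  (hdim : topologicalKrullDim C ≤ 1)
include hdim

theorem isCousinFamily_component [IsProper (C ↘ Spec (.of ℂ))]
    (hη : i (genericPoint Z) ∈ genericPoints C) :
    IsCousinFamily Z.functionField
      fun q : {z : Z // z ≠ genericPoint Z} => Z.presheaf.stalk q.1 := by
  have : IsProper (Z ↘ Spec (.of ℂ)) := by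
    rw [← (Scheme.Hom.isOver_iff (Spec (.of ℂ)) (f := i)).1 inferInstance]
    infer_instance
  have : NoetherianSpace Z := i.isEmbedding.isInducing.noetherianSpace
  refine isCousinFamily_stalk Z
    ((i.isEmbedding.isInducing.topologicalKrullDim_le).trans hdim) fun q x => ?_
  have hq := apply_notMem_genericPoints i q.2
  obtain ⟨y, rfl⟩ := i.stalkMap_surjective _ x
  let U : C.Opens := ⟨{i q.1}ᶜ, (isClosed_singleton_of_notMem_genericPoints hdim hq).isOpen_compl⟩
  have hU (x : C) : x ∈ U ↔ x ≠ i q.1 := Iff.rfl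
  classical
  obtain ⟨g, h, H⟩ := exists_germ_add_stalkSpecializes_eq C hdim U hU
    (fun η h => hq (h ▸ η.2)) (Function.update 0 ⟨i (genericPoint Z), hη⟩ y)
  have H := H ⟨_, hη⟩ (((genericPoint_spec Z).specializes trivial).map i.continuous)
  rw [Function.update_self] at H
  refine ⟨stalkHom i (genericPoint Z) specializes_rfl (C.presheaf.germ U _
    (fun h => hq (h ▸ hη)) g), fun q' hq' => ?_, stalkHom i q.1 specializes_rfl h, ?_⟩
  · exact stalkHom_germ_mem_range i g _ _ fun h => hq' (Subtype.ext (i.isEmbedding.injective h))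
  · rw [algebraMap_stalkHom, ← H, map_add, ← stalkHom_rfl, ← stalkHom_rfl,
      stalkHom_stalkSpecializes]

end Component

/-! ### Smoothness and rationality -/

section Smooth

theorem isIso_germ_top_of_Spec {K : Type} [Field K] (x : Spec (.of K)) :
    IsIso ((Spec (.of K)).presheaf.germ ⊤ x trivial) := by
  obtain rfl : x = closedPoint K := Subsingleton.elim (α := PrimeSpectrum K) _ _
  have := ΓSpecIso_hom_stalkClosedPointIso_inv (R := .of K)
  exact this ▸ inferInstance

variable (Z : Scheme.{0}) [Z.Over (Spec (.of ℂ))]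

theorem formallySmooth_stalkMap_iff_algebra (z : Z) :
    ((Z ↘ Spec (.of ℂ)).stalkMap z).hom.FormallySmooth ↔
      Algebra.FormallySmooth ℂ (Z.presheaf.stalk z) := by
  have := isIso_germ_top_of_Spec ((Z ↘ Spec (.of ℂ)) z)
  let e := (Scheme.ΓSpecIso (.of ℂ)).inv ≫
    (Spec (.of ℂ)).presheaf.germ ⊤ ((Z ↘ Spec (.of ℂ)) z) trivial
  have he : e ≫ (Z ↘ Spec (.of ℂ)).stalkMap z =
      CommRingCat.ofHom (algebraMap ℂ (Z.presheaf.stalk z)) := by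
    exact congrArg ((Scheme.ΓSpecIso (.of ℂ)).inv ≫ ·)
      (Scheme.Hom.germ_stalkMap (Z ↘ Spec (.of ℂ)) ⊤ z trivial)
  rw [← RingHom.FormallySmooth.respectsIso.cancel_left_isIso e, ← RingHom.formallySmooth_algebraMap,
    ← CommRingCat.hom_comp, he]
  rfl

theorem smooth_of_isLineGerm [IsIntegral Z] [LocallyOfFiniteType (Z ↘ Spec (.of ℂ))]
    (H : ∀ z ≠ genericPoint Z, ∃ x : Z.presheaf.stalk z, IsLineGerm (Z.presheaf.stalk z) x) :
    Smooth (Z ↘ Spec (.of ℂ)) := by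
  rw [← Scheme.Hom.smoothLocus_eq_top_iff, eq_top_iff]
  intro z _
  obtain rfl | hz := eq_or_ne z (genericPoint Z)
  · exact Scheme.Hom.genericPoint_mem_smoothLocus_of_perfectField _
  · obtain ⟨x, hx⟩ := H z hz
    rw [Scheme.Hom.mem_smoothLocus, formallySmooth_stalkMap_iff_algebra]
    exact hx.formallySmooth

end Smooth

section Birational

open Polynomial IntermediateField

theorem isDominant_of_isOpenImmersion {U X : Scheme.{0}} (f : U ⟶ X) [IsOpenImmersion f]
    [Nonempty U] [IrreducibleSpace X] : IsDominant f :=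
  ⟨f.isOpenEmbedding.isOpen_range.dense (Set.range_nonempty f)⟩

variable (Z : Scheme.{0}) [Z.Over (Spec (.of ℂ))] [IsIntegral Z]
  [LocallyOfFiniteType (Z ↘ Spec (.of ℂ))]

theorem birationalOver_affineLine (x : Z.functionField) (htop : ℂ⟮x⟯ = ⊤)
    (hinj : Function.Injective (aeval x : ℂ[X] → Z.functionField)) :
    Scheme.BirationalOver (Z ↘ Spec (.of ℂ)) (𝔸(Unit; Spec (.of ℂ)) ↘ Spec (.of ℂ)) := by
  obtain ⟨_, ⟨W, hW, rfl⟩, hη, -⟩ := Z.isBasis_affineOpens.exists_subset_of_mem_open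
    (Set.mem_univ (genericPoint Z)) isOpen_univ
  have : IsOpenImmersion hW.fromSpec := hW.isOpenImmersion_fromSpec
  have hne : Nonempty W := ⟨⟨_, hη⟩⟩
  let ψ : CommRingCat.of ℂ ⟶ Γ(Z, W) := Spec.preimage (hW.fromSpec ≫ (Z ↘ Spec (.of ℂ)))
  have hψ : Spec.map ψ = hW.fromSpec ≫ (Z ↘ Spec (.of ℂ)) := Spec.map_preimage _
  let _ : Algebra ℂ Γ(Z, W) := ψ.hom.toAlgebra
  have : Algebra.FiniteType ℂ Γ(Z, W) := by
    have : LocallyOfFiniteType (Spec.map ψ) := by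
      rw [hψ]
      exact MorphismProperty.comp_mem @LocallyOfFiniteType _ _ inferInstance inferInstance
    exact (HasRingHomProperty.Spec_iff (P := @LocallyOfFiniteType)).1 this
  have : IsScalarTower ℂ Γ(Z, W) Z.functionField := by
    have : ψ ≫ Z.germToFunctionField W =
        CommRingCat.ofHom (algebraMap ℂ Z.functionField) := by
      apply Spec.map_injective
      rw [Spec.map_comp, hψ, ← Category.assoc, ← fromSpecStalk_over,
        ← hW.fromSpecStalk_eq_fromSpecStalk hη]
      rfl
    exact .of_algebraMap_eq fun c => (ConcreteCategory.congr_hom this c).symm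
  have := functionField_isFractionRing_of_isAffineOpen Z W hW
  obtain ⟨b, v, hb, hv, ⟨e⟩⟩ := exists_away_algEquiv (B := Γ(Z, W)) x htop hinj
  have : Nontrivial (Localization.Away b) :=
    (IsLocalization.injective (Localization.Away b)
      (powers_le_nonZeroDivisors_of_noZeroDivisors hb)).nontrivial
  have : Nonempty (Spec (.of (Localization.Away b))) :=
    inferInstanceAs (Nonempty (PrimeSpectrum (Localization.Away b)))
  let s := Spec.map (CommRingCat.ofHom (algebraMap ℂ (Localization.Away b)))
  let j₁ : Spec (.of (Localization.Away b)) ⟶ Z :=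
    Spec.map (CommRingCat.ofHom (algebraMap Γ(Z, W) (Localization.Away b))) ≫ hW.fromSpec
  let j₂ : Spec (.of (Localization.Away b)) ⟶ 𝔸(Unit; Spec (.of ℂ)) :=
    (Spec.map e.toRingEquiv.toCommRingCatIso.hom ≫
      Spec.map (CommRingCat.ofHom (algebraMap ℂ[X] (Localization.Away v)))) ≫
        Spec.map (MvPolynomial.uniqueAlgEquiv ℂ Unit).toRingEquiv.toCommRingCatIso.hom ≫
          (AffineSpace.SpecIso Unit (.of ℂ)).inv
  have hj₁ : j₁ ≫ (Z ↘ Spec (.of ℂ)) = s := by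
    rw [Category.assoc, ← hψ, ← Spec.map_comp]
    rfl
  have hj₂ : j₂ ≫ (𝔸(Unit; Spec (.of ℂ)) ↘ Spec (.of ℂ)) = s := by
    simp only [j₂, Category.assoc, AffineSpace.SpecIso_inv_over, ← Spec.map_comp]
    congr 1
    ext c
    change e (algebraMap ℂ[X] (Localization.Away v) (MvPolynomial.uniqueAlgEquiv ℂ Unit
      (algebraMap ℂ (MvPolynomial Unit ℂ) c))) = algebraMap ℂ (Localization.Away b) c
    rw [AlgEquiv.commutes, ← IsScalarTower.algebraMap_apply, AlgEquiv.commutes]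
  have : IsOpenImmersion j₁ :=
    MorphismProperty.comp_mem @IsOpenImmersion _ _ inferInstance inferInstance
  have : IsOpenImmersion j₂ := inferInstance
  have := isDominant_of_isOpenImmersion j₁
  have := isDominant_of_isOpenImmersion j₂
  exact (j₁.birationalOver _ _ hj₁).symm.trans (j₂.birationalOver _ _ hj₂)

end Birational

/-! ### The local rings of a curve with `H¹(𝒪) = 0` -/

theorem eq_zero_of_forall_stalkSpecializes_eq_zero {X : Scheme.{0}} [IsReduced X]
    [NoetherianSpace X] {p : X} (a : X.presheaf.stalk p)
    (ha : ∀ (η : X) (h : η ⤳ p), η ∈ genericPoints X → X.presheaf.stalkSpecializes h a = 0) :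
    a = 0 := by
  have hcl : IsClosed (⋃ (η ∈ {η ∈ genericPoints X | ¬ η ⤳ p}), closure {η}) :=
    ((genericPoints.finite NoetherianSpace.finite_irreducibleComponents).subset
      fun _ h => h.1).isClosed_biUnion fun _ _ => isClosed_closure
  let V : X.Opens := ⟨_, hcl.isOpen_compl⟩
  have hpV : p ∈ V := by
    intro hp
    obtain ⟨η, ⟨-, hη⟩, hpη⟩ := Set.mem_iUnion₂.1 hp
    exact hη (specializes_iff_mem_closure.2 hpη)
  obtain ⟨U, hUV, hpU, f, rfl⟩ := X.presheaf.exists_le_germ_eq a hpV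
  suffices X.basicOpen f = ⊥ by
    rw [(basicOpen_eq_bot_iff f).1 this]
    exact map_zero (X.presheaf.germ U p hpU).hom
  by_contra hne
  obtain ⟨y, hy⟩ : ∃ y, y ∈ X.basicOpen f := by
    by_contra! H
    exact hne (TopologicalSpace.Opens.ext (Set.eq_empty_of_forall_notMem H))
  let η := genericPoints.ofComponent ⟨_, irreducibleComponent_mem_irreducibleComponents y⟩
  have hηy : η.1 ⤳ y := by
    rw [specializes_iff_mem_closure, (genericPoints.isGenericPoint_ofComponent
      ⟨_, irreducibleComponent_mem_irreducibleComponents y⟩).def]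
    exact mem_irreducibleComponent
  have hηf : η.1 ∈ X.basicOpen f := hηy.mem_open (X.basicOpen f).isOpen hy
  have hηU : η.1 ∈ U := X.basicOpen_le f hηf
  have hηp : η.1 ⤳ p := by
    by_contra h
    exact hUV hηU (Set.mem_iUnion₂.2 ⟨η.1, ⟨η.2, h⟩, subset_closure rfl⟩)
  have h0 := ha η.1 hηp η.2
  rw [← ConcreteCategory.comp_apply, X.presheaf.germ_stalkSpecializes] at h0
  rw [Scheme.mem_basicOpen _ _ _ hηU, h0] at hηf
  exact not_isUnit_zero hηf

theorem exists_forall_apply_eq {ι α : Type} {β : α → Type} [∀ a, Nonempty (β a)] {f : ι → α}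
    (hf : Function.Injective f) (y : ∀ i, β (f i)) : ∃ φ : ∀ a, β a, ∀ i, φ (f i) = y i := by
  have (a : α) : ∃ b : β a, ∀ (i : ι) (h : f i = a), h ▸ y i = b := by
    by_cases h : ∃ i, f i = a
    · obtain ⟨i, rfl⟩ := h
      refine ⟨y i, fun i' h' => ?_⟩
      obtain rfl := hf h'
      rfl
    · exact ⟨Classical.arbitrary _, fun i hi => (h ⟨i, hi⟩).elim⟩
  choose φ hφ using this
  exact ⟨φ, fun i => (hφ _ i rfl).symm⟩

instance (X : Scheme.{0}) [X.Over (Spec (.of ℂ))] (Z : Closeds X) :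
    (reducedSubscheme X Z).Over (Spec (.of ℂ)) :=
  ⟨reducedSubschemeι X Z ≫ X ↘ Spec (.of ℂ)⟩

instance (X : Scheme.{0}) [X.Over (Spec (.of ℂ))] (Z : Closeds X) :
    (reducedSubschemeι X Z).IsOver (Spec (.of ℂ)) :=
  ⟨rfl⟩

theorem reducedSubschemeι_genericPoint (X : Scheme.{0}) (Z : Closeds X)
    [IsIntegral (reducedSubscheme X Z)] :
    IsGenericPoint (reducedSubschemeι X Z (genericPoint (reducedSubscheme X Z))) (Z : Set X) := by
  have := (genericPoint_spec (reducedSubscheme X Z)).image (reducedSubschemeι X Z).continuous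
  rwa [Set.image_univ, range_reducedSubschemeι, Z.isClosed.closure_eq] at this

section Fold

variable (C : Scheme.{0}) [C.Over (Spec (.of ℂ))] [IsReduced C]
  [NoetherianSpace C] [Subsingleton (structureCohomology C 1)] [IsProper (C ↘ Spec (.of ℂ))]
  (hdim : topologicalKrullDim C ≤ 1)
include hdim

theorem exists_isFoldedGerm {p : C} (hp : p ∉ genericPoints C) :
    ∃ (k : ℕ) (D : Fin k → Type) (_ : ∀ j, CommRing (D j)) (_ : ∀ j, Algebra ℂ (D j))
      (x : ∀ j, D j) (π : ∀ j, C.presheaf.stalk p →ₐ[ℂ] D j),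
      IsFoldedGerm (C.presheaf.stalk p) D x π ∧ ∀ j, IsRegularLocalRing (D j) := by
  have hfin : Finite (genericPoints C) :=
    genericPoints.finite NoetherianSpace.finite_irreducibleComponents
  let k := Nat.card {η : genericPoints C // η.1 ⤳ p}
  let e : Fin k ≃ {η : genericPoints C // η.1 ⤳ p} := (Finite.equivFin _).symm
  let T (j : Fin k) : Closeds C := ⟨closure {(e j).1.1}, isClosed_closure⟩
  let Z (j : Fin k) : Scheme.{0} := reducedSubscheme C (T j)
  let i (j : Fin k) : Z j ⟶ C := reducedSubschemeι C (T j)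
  have hint (j : Fin k) : IsIntegral (Z j) :=
    isIntegral_reducedSubscheme isIrreducible_singleton.closure
  have hgen (j : Fin k) : i j (genericPoint (Z j)) = (e j).1.1 :=
    (reducedSubschemeι_genericPoint C (T j)).eq isGenericPoint_closure
  have hmem (j : Fin k) : i j (genericPoint (Z j)) ∈ genericPoints C := by
    rw [hgen]
    exact (e j).1.2
  have hq (j : Fin k) : ∃ q : Z j, i j q = p := by
    have : p ∈ Set.range (i j) := by
      rw [range_reducedSubschemeι]
      exact (e j).2.mem_closure
    exact this
  choose q hq using hq
  have hqg (j : Fin k) : q j ≠ genericPoint (Z j) := fun h => hp (by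
    rw [← hq j, h]
    exact hmem j)
  have (j : Fin k) : IsLocallyNoetherian (Z j) :=
    LocallyOfFiniteType.isLocallyNoetherian (i j ≫ C ↘ Spec (.of ℂ))
  have H (j : Fin k) := isCousinFamily_component (i j) hdim (hmem j)
  choose x hx using fun j => (H j).exists_isLineGerm ⟨q j, hqg j⟩
  let π (j : Fin k) := stalkHom (i j) (q j) (specializes_of_eq (hq j))
  have hπ (j : Fin k) (a : C.presheaf.stalk p) : algebraMap _ (Z j).functionField (π j a) =
      stalkHom (i j) (genericPoint (Z j)) (specializes_of_eq (hgen j))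
        (C.presheaf.stalkSpecializes (e j).2 a) := by
    rw [stalkHom_stalkSpecializes]
    exact algebraMap_stalkHom (i j) (q j) (specializes_of_eq (hq j)) a
  refine ⟨k, fun j => (Z j).presheaf.stalk (q j), inferInstance, inferInstance, x, π,
    ⟨fun j => (hx j).1, fun j => stalkHom_surjective (i j) (q j) (hq j), ?_, ?_, ?_⟩, ?_⟩
  · intro a ha
    refine eq_zero_of_forall_stalkSpecializes_eq_zero a fun η hη hηg => ?_
    obtain ⟨j, hj⟩ := e.surjective ⟨⟨η, hηg⟩, hη⟩
    obtain rfl : (e j).1.1 = η := by rw [hj]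
    have hf := isField_stalk_of_closure_mem_irreducibleComponents C _ (e j).1.2
    by_contra h0
    obtain ⟨b, hb⟩ := hf.mul_inv_cancel h0
    have h := congrArg (stalkHom (i j) (genericPoint (Z j)) (specializes_of_eq (hgen j))) hb
    rw [map_mul, ← hπ, ha, map_zero, zero_mul, map_one] at h
    exact zero_ne_one h
  · exact exists_sub_algebraMap_mem_maximalIdeal
      (isClosed_singleton_of_notMem_genericPoints hdim hp)
  · intro d
    choose y hy using fun j => stalkHom_surjective (i j) (genericPoint (Z j)) (hgen j)
      (algebraMap _ (Z j).functionField (d j))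
    obtain ⟨φ, hφ⟩ := exists_forall_apply_eq (β := fun η : genericPoints C => C.presheaf.stalk η.1)
      (Subtype.val_injective.comp e.injective) y
    let U : C.Opens := ⟨{p}ᶜ, (isClosed_singleton_of_notMem_genericPoints hdim hp).isOpen_compl⟩
    obtain ⟨g, h, hgh⟩ := exists_germ_add_stalkSpecializes_eq C hdim U (fun _ => Iff.rfl)
      (fun η h => hp (h ▸ η.2)) φ
    have hgU (j : Fin k) : (e j).1.1 ∈ U := fun h => hp (h ▸ (e j).1.2)
    let G (j : Fin k) : (Z j).functionField := stalkHom (i j) (genericPoint (Z j))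
      (specializes_of_eq (hgen j)) (C.presheaf.germ U (e j).1.1 (hgU j) g)
    have hG (j : Fin k) : G j + algebraMap _ (Z j).functionField (π j h) =
        algebraMap _ (Z j).functionField (d j) := by
      rw [hπ, ← hy, ← map_add]
      congr 1
      exact (hgh (e j).1 (e j).2).trans (hφ j)
    have hconst (j : Fin k) : ∃ c : ℂ, algebraMap ℂ (Z j).functionField c = G j := by
      refine (H j).eq_const_of_mem_range fun q' => ?_
      obtain hq' | hq' := eq_or_ne (i j q'.1) p
      · obtain rfl : q' = ⟨q j, hqg j⟩ :=
          Subtype.ext ((i j).isEmbedding.injective (hq'.trans (hq j).symm))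
        exact ⟨d j - π j h, by rw [map_sub, ← hG, add_sub_cancel_right]⟩
      · exact stalkHom_germ_mem_range (i j) g _ _ hq'
    choose c hc using hconst
    refine ⟨c, h, fun j => IsFractionRing.injective _ (Z j).functionField ?_⟩
    rw [map_add, ← IsScalarTower.algebraMap_apply, hc, hG]
  · intro j
    have := (H j).isDiscreteValuationRing ⟨q j, hqg j⟩
    infer_instance

theorem exists_isRationalFoldLocalRing {p : C} (hp : IsSingularPoint C p) :
    ∃ k, 2 ≤ k ∧ IsRationalFoldLocalRing (C.presheaf.stalk p) k := by
  have hpg : p ∉ genericPoints C := fun h => hp (by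
    have hf := isField_stalk_of_closure_mem_irreducibleComponents C _ h
    have := hf.isDomain
    have := hf.isPrincipalIdealRing
    infer_instance)
  obtain ⟨k, D, _, _, x, π, H, hD⟩ := exists_isFoldedGerm C hdim hpg
  refine ⟨k, ?_, H.isRationalFoldLocalRing⟩
  by_contra! hk
  interval_cases k
  · exact one_ne_zero (H.eq_zero 1 fun j => j.elim0)
  · have := hD 0
    exact hp (.of_ringEquiv (RingEquiv.ofBijective (π 0) ⟨(injective_iff_map_eq_zero _).2
      fun a ha => H.eq_zero a fun j => by rwa [Subsingleton.elim j 0], H.surjective 0⟩).symm)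

end Fold

theorem isSmoothRationalCurve_component (C : Scheme.{0}) [C.Over (Spec (.of ℂ))]
    [NoetherianSpace C] [ConnectedSpace C] [Subsingleton (structureCohomology C 1)]
    [IsProper (C ↘ Spec (.of ℂ))] (hdim : topologicalKrullDim C = 1) (Z : Closeds C)
    (hZ : (Z : Set C) ∈ irreducibleComponents C) :
    IsSmoothRationalCurve (reducedSubscheme C Z ↘ Spec (.of ℂ)) := by
  have hint : IsIntegral (reducedSubscheme C Z) := isIntegral_reducedSubscheme hZ.1
  have hη : reducedSubschemeι C Z (genericPoint (reducedSubscheme C Z)) ∈ genericPoints C := by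
    change closure {reducedSubschemeι C Z (genericPoint (reducedSubscheme C Z))} ∈
      irreducibleComponents C
    rwa [(reducedSubschemeι_genericPoint C Z).def]
  have : LocallyOfFiniteType (reducedSubscheme C Z ↘ Spec (.of ℂ)) :=
    inferInstanceAs (LocallyOfFiniteType (reducedSubschemeι C Z ≫ C ↘ Spec (.of ℂ)))
  have : IsLocallyNoetherian (reducedSubscheme C Z) :=
    LocallyOfFiniteType.isLocallyNoetherian (reducedSubscheme C Z ↘ Spec (.of ℂ))
  have H := isCousinFamily_component (reducedSubschemeι C Z) hdim.le hη
  obtain ⟨z, hz⟩ := exists_ne_genericPoint (reducedSubschemeι C Z) hdim hη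
  obtain ⟨x, -, htop, hinj⟩ := H.exists_isLineGerm ⟨z, hz⟩
  exact ⟨hint, smooth_of_isLineGerm _ fun z hz => (H.exists_isLineGerm ⟨z, hz⟩).imp fun _ h => h.1,
    birationalOver_affineLine _ _ htop hinj⟩

end CurveGenusZero

end

theorem mainTheorem12 (C : Scheme.{0}) (s : C ⟶ Spec (.of ℂ))
    [IsProper s] [IsReduced C] [ConnectedSpace C] (hdim : topologicalKrullDim C = 1)
    (hgenus : CurveGenusZero.HasArithmeticGenus s 0) :
    (∀ Z : TopologicalSpace.Closeds C, (Z : Set C) ∈ irreducibleComponents C →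
      CurveGenusZero.IsSmoothRationalCurve (CurveGenusZero.reducedSubschemeι C Z ≫ s)) ∧
    (∀ p : C, CurveGenusZero.IsSingularPoint C p →
      ∃ k : ℕ, 2 ≤ k ∧ CurveGenusZero.IsRationalFoldPoint s p k) := by
  let _ : C.Over (Spec (.of ℂ)) := ⟨s⟩
  have hs : IsProper (C ↘ Spec (.of ℂ)) := ‹IsProper s›
  have : IsLocallyNoetherian C := LocallyOfFiniteType.isLocallyNoetherian s
  have : CompactSpace C := (quasiCompact_iff_compactSpace s).1 inferInstance
  have : IsNoetherian C := {}
  have : Subsingleton (CurveGenusZero.structureCohomology C 1) :=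
    CurveGenusZero.subsingleton_structureCohomology_one s (CurveGenusZero.scalars_surjective s)
      hgenus
  exact ⟨fun Z hZ => CurveGenusZero.isSmoothRationalCurve_component C hdim Z hZ,
    fun p hp => CurveGenusZero.exists_isRationalFoldLocalRing C hdim.le hp⟩
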